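/- **Calculi.** Fix a countably infinite set of names; processes are considered up to $\alpha$-conversion. *CPC.* Patterns are $p ::= \lambda x \mid x \mid \ulcorner x\urcorner \mid p\bullet p$ (binding, variable, protected names; compounds, associating to the left), with the binding names of a pattern pairwise distinct and different from its free names. A pattern is communicable if it has no binding and no protected names; substitutions map names to communicable patterns, and $\ulcorner p\bullet q\urcorner=\ulcorner p\urcorner\bullet\ulcorner q\urcorner$. Unification $\{p\|q\}$ is the partial function with $\{x\|x\}=\{x\|\ulcorner x\urcorner\}=\{\ulcorner x\urcorner\|x\}=\{\ulcorner x\urcorner\|\ulcorner x\urcorner\}=(\{\},\{\})$; $\{\lambda x\|q\}=(\{q/x\},\{\})$ and $\{q\|\lambda x\}=(\{\},\{q/x\})$ for $q$ communicable; $\{p_1\bullet p_2\|q_1\bullet q_2\}=(\sigma_1\cup\sigma_2,\rho_1\cup\rho_2)$ if $\{p_i\|q_i\}=(\sigma_i,\rho_i)$ for $i=1,2$; undefined otherwise. Processes are $P::=\mathbf 0\mid\surd\mid P|P\mid\,!P\mid(\nu x)P\mid p\to P$, where $p\to P$ binds the binding names of $p$ in $P$, and $p$ alone abbreviates $p\to\mathbf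 0$. Structural congruence $\equiv$ is the congruence generated by: $|$ is a commutative monoid with unit $\mathbf 0$, $(\nu n)\mathbf 0\equiv\mathbf 0$, $(\nu n)(\nu m)P\equiv(\nu m)(\nu n)P$, $!P\equiv P|!P$, and $P|(\nu n)Q\equiv(\nu n)(P|Q)$ for $n\notin\mathrm{fn}(P)$. Reduction $\mapsto$ is generated by $(p\to P)|(q\to Q)\mapsto\sigma P|\rho Q$ if $\{p\|q\}=(\sigma,\rho)$, and closed under parallel composition, restriction and $\equiv$. $P$ exhibits the barb $\tilde m$ if $P\equiv(\nu\tilde n)(p\to P'|P'')$ with no protected name of $p$ in $\tilde n$ and $\tilde m=\mathrm{fn}(p)\setminus\tilde n$. Barbed congruence $\simeq$ is the largest relation on CPC processes that is symmetric, preserves barbs, is reduction closed ($P\mathrel R Q$ and $P\mapsto P'$ imply $Q\mapsto Q'$ with $P'\mathrel R Q'$) and is closed under all one-hole CPC contexts. *Spi calculus.* Terms are $M::=n\mid(M,N)\mid 0\mid \mathit{suc}(M)\mid\{M\}_N$ with $n$ a name (variables are names; a numeral $i>0$ is the $i$-th successor of $0$). Processes are $$\begin{aligned}P::={}&\mathbf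 0\mid\surd\mid P|P\mid\,!P\mid(\nu m)P\mid M(x).P\mid\overline M\langle N\rangle.P\mid[M\text{ is }N]P\mid\text{let }(x,y)=M\text{ in }P\\&\mid\text{case }M\text{ of }\{x\}_N:P\mid\text{case }M\text{ of }0:P\ suc(x):Q\end{aligned}$$ with $x\neq y$ in a splitting, and the same structural congruence laws. Reduction is generated by $$\begin{aligned}\overline M\langle N\rangle.P\,|\,M(x).Q&\mapsto P\,|\,\{N/x\}Q, & [M\text{ is }M]P&\mapsto P,\\ \text{let }(x,y)=(M,N)\text{ in }P&\mapsto\{M/x,N/y\}P, & \text{case }\{M\}_N\text{ of }\{x\}_N:P&\mapsto\{M/x\}P,\\ \text{case }0\text{ of }0:P\ suc(x):Q&\mapsto P, & \text{case }suc(N)\text{ of }0:P\ suc(x):Q&\mapsto\{N/x\}Q,\end{aligned}$$ and is closed under parallel composition, restriction and $\equiv$. **The encoding.** Let $\iota$ be an injection of the Spi names into the CPC names, and let $\mathsf{pair},\mathsf{encr},\mathsf 0,\mathsf{suc},\mathsf{in}$ be distinct (reserved) CPC names outside the range of $\iota$. Terms become communicable patterns: $[\![n]\!]=\iota(n)$,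 $[\![0]\!]=\mathsf 0$, $[\![suc(M)]\!]=\mathsf{suc}\bullet[\![M]\!]$, $[\![(M,N)]\!]=\mathsf{pair}\bullet[\![M]\!]\bullet[\![N]\!]$, $[\![\{M\}_N]\!]=\mathsf{encr}\bullet[\![M]\!]\bullet[\![N]\!]$. On processes $[\![\cdot]\!]$ is homomorphic for $\mathbf 0,\surd,|,!,\nu$, and (identifying a Spi name with its image under $\iota$; $n$ and the $x$ of the output clause are fresh) $$\begin{aligned} [\![M(x).P]\!]&=[\![M]\!]\bullet\lambda x\bullet\mathsf{in}\to[\![P]\!]\\ [\![\overline M\langle N\rangle.P]\!]&=[\![M]\!]\bullet[\![N]\!]\bullet\lambda x\to[\![P]\!]\\ [\![[M\text{ is }N]P]\!]&=(\nu n)(\ulcorner n\urcorner\bullet[\![M]\!]\to[\![P]\!]\;|\;\ulcorner n\urcorner\bullet[\![N]\!])\\ [\![\text{let }(x,y)=M\text{ in }P]\!]&=(\nu n)(\ulcorner n\urcorner\bullet(\ulcorner\mathsf{pair}\urcorner\bullet\lambda x\bullet\lambda y)\to[\![P]\!]\;|\;\ulcorner n\urcorner\bullet[\![M]\!])\\ [\![\text{case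 }M\text{ of }\{x\}_N:P]\!]&=(\nu n)(\ulcorner n\urcorner\bullet(\ulcorner\mathsf{encr}\urcorner\bullet\lambda x\bullet[\![N]\!])\to[\![P]\!]\;|\;\ulcorner n\urcorner\bullet[\![M]\!])\\ [\![\text{case }M\text{ of }0:P\ suc(x):Q]\!]&=(\nu n)(\ulcorner n\urcorner\bullet\ulcorner\mathsf 0\urcorner\to[\![P]\!]\;|\;\ulcorner n\urcorner\bullet(\ulcorner\mathsf{suc}\urcorner\bullet\lambda x)\to[\![Q]\!]\;|\;\ulcorner n\urcorner\bullet[\![M]\!]) \end{aligned}$$ **Theorem.** Write $\Mapsto$ for the reflexive-transitive closure of $\mapsto$, $P\mapsto^\omega$ if $P$ has an infinite sequence of reductions, and $P\Downarrow$ if $P\Mapsto P'\equiv P''|\surd$ for some $P',P''$. (A) The encoding $[\![\cdot]\!]$, with the renaming policy $\varphi(a)=(\iota(a))$ (a tuple of length one), is valid: 1. *Compositionality.* For every $k$-ary Spi operator $\mathsf{op}$ (with its terms and bound names) and every set of names $N$ there is a $k$-ary CPC context $C$ (each of its $k$ holes occurs exactly once, and its binders may capture) such that $[\![\mathsf{op}(S_1,\dots,S_k)]\!]=C[[\![S_1]\!];\dots;[\![S_k]\!]]$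 for all $S_1,\dots,S_k$ with $\mathrm{fn}(S_1,\dots,S_k)=N$. Here the free names of a pattern in $C$ lie outside the scope of its binding names. 2. *Name invariance.* For every name substitution $\sigma$ there is a substitution $\sigma'$ of CPC names with $\varphi(\sigma(a))=\sigma'(\varphi(a))$ for every Spi name $a$, and fixing every name not occurring in any $\varphi(a)$, such that for every $S$: $[\![\sigma S]\!]=\sigma'[\![S]\!]$ if $\sigma$ is injective, and $[\![\sigma S]\!]\simeq\sigma'[\![S]\!]$ otherwise. 3. *Operational correspondence.* If $S\Mapsto S'$ then $[\![S]\!]\Mapsto\simeq[\![S']\!]$; if $[\![S]\!]\Mapsto T$ then there is $S'$ with $S\Mapsto S'$ and $T\Mapsto\simeq[\![S']\!]$. 4. *Divergence reflection.* If $[\![S]\!]\mapsto^\omega$ then $S\mapsto^\omega$. 5. *Success sensitiveness.* $S\Downarrow$ if and only if $[\![S]\!]\Downarrow$. (B) Reductions are preserved and reflected up to $\simeq$: if $P\mapsto P'$ then $[\![P]\!]\mapsto\simeq[\![P']\!]$; and if $[\![P]\!]\mapsto Q$ then $Q\simeq[\![P']\!]$ for some $P'$ with $P\mapsto P'$. 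-/

import Mathlib

/-!
Conventions.  Names are natural numbers.  Processes are taken up to alpha-conversion, which is
realised by de Bruijn indices: inside `k` binders the indices `0, ..., k - 1` are the bound names
(`0` for the innermost binder) and the index `n + k` is the name `n` of the scope outside these
binders.  A construct that binds several names at once (a case, a pair splitting) numbers them from
left to right.  `closeNames` turns a process with chosen names for its binders into this form.
-/

/-- The passage under binders that are called `xs` (pairwise distinct names): the name `xs[i]`
becomes the bound index `i`, every other name is moved under the binders. -/
def closeNames (xs : List ℕ) (n : ℕ) : ℕ :=
  if n ∈ xs then xs.idxOf n else n + xs.length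

/-- The renaming `f`, moved under `k` binders. -/
def liftRenaming (k : ℕ) (f : ℕ → ℕ) (i : ℕ) : ℕ :=
  if i < k then i else f (i - k) + k

/-! ### Concurrent pattern calculus (CPC), with the success process -/

namespace CPC

/-- Communicable patterns: those without protected and binding names. -/
inductive Comm : Type
  | name (n : ℕ)
  | comp (c d : Comm)

/-- Patterns.  The binding names are anonymous: the `i`-th occurrence of `bind`, from the left and
counted from `0`, binds the index `i` in the body of the case.  So the binding names of a pattern
are automatically distinct from each other and from its free names. -/
inductive Pat : Type
  | bind
  | var (n : ℕ)
  | prot (n : ℕ)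
  | comp (p q : Pat)

namespace Comm

/-- A communicable pattern as a pattern. -/
def toPat : Comm → Pat
  | name n => .var n
  | comp c d => .comp c.toPat d.toPat

/-- Protection, extended from names to communicable patterns. -/
def protect : Comm → Pat
  | name n => .prot n
  | comp c d => .comp c.protect d.protect

/-- Renaming of names. -/
def rename (f : ℕ → ℕ) : Comm → Comm
  | name n => name (f n)
  | comp c d => comp (c.rename f) (d.rename f)

end Comm

namespace Pat

/-- The number of binding names of a pattern. -/
def binders : Pat → ℕ
  | bind => 1
  | var _ => 0
  | prot _ => 0
  | comp p q => p.binders + q.binders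

/-- The protected names of a pattern. -/
def pn : Pat → Set ℕ
  | bind => ∅
  | var _ => ∅
  | prot n => {n}
  | comp p q => p.pn ∪ q.pn

/-- The free names (variable names and protected names) of a pattern. -/
def fn : Pat → Set ℕ
  | bind => ∅
  | var n => {n}
  | prot n => {n}
  | comp p q => p.fn ∪ q.fn

/-- Application of a substitution to (the free names of) a pattern. -/
def subst (f : ℕ → Comm) : Pat → Pat
  | bind => bind
  | var n => (f n).toPat
  | prot n => (f n).protect
  | comp p q => comp (p.subst f) (q.subst f)

end Pat

/-- Unification of patterns: `Unify p q σ ρ` says that `{p || q} = (σ, ρ)`, where a substitution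
whose domain is the set of binding names of a pattern is given by the list of its values. -/
inductive Unify : Pat → Pat → List Comm → List Comm → Prop
  | var_var (n : ℕ) : Unify (.var n) (.var n) [] []
  | var_prot (n : ℕ) : Unify (.var n) (.prot n) [] []
  | prot_var (n : ℕ) : Unify (.prot n) (.var n) [] []
  | prot_prot (n : ℕ) : Unify (.prot n) (.prot n) [] []
  | bind_left (q : Pat) (c : Comm) (h : q = c.toPat) : Unify .bind q [c] []
  | bind_right (p : Pat) (c : Comm) (h : p = c.toPat) : Unify p .bind [] [c]
  | comp {p₁ p₂ q₁ q₂ : Pat} {σ₁ σ₂ ρ₁ ρ₂ : List Comm} :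
      Unify p₁ q₁ σ₁ ρ₁ → Unify p₂ q₂ σ₂ ρ₂ →
        Unify (.comp p₁ p₂) (.comp q₁ q₂) (σ₁ ++ σ₂) (ρ₁ ++ ρ₂)

/-- Processes: null, success, parallel composition, replication, restriction (binding the index `0`
in its body) and case (its pattern binds the indices `0, ..., p.binders - 1` in its body). -/
inductive Proc : Type
  | nil
  | ok
  | par (P Q : Proc)
  | repl (P : Proc)
  | res (P : Proc)
  | case (p : Pat) (P : Proc)

/-- The substitution `f`, moved under `k` binders. -/
def liftSubst (k : ℕ) (f : ℕ → Comm) (i : ℕ) : Comm :=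
  if i < k then .name i else (f (i - k)).rename (· + k)

/-- The substitution that replaces the bound indices `0, ..., σ.length - 1` by the values in `σ` and
removes their binders. -/
def inst (σ : List Comm) (i : ℕ) : Comm :=
  σ.getD i (.name (i - σ.length))

namespace Proc

/-- Capture-avoiding substitution. -/
def subst (f : ℕ → Comm) : Proc → Proc
  | nil => nil
  | ok => ok
  | par P Q => par (P.subst f) (Q.subst f)
  | repl P => repl (P.subst f)
  | res P => res (P.subst (liftSubst 1 f))
  | case p P => case (p.subst f) (P.subst (liftSubst p.binders f))

/-- Substitution of names for names. -/
def rename (f : ℕ → ℕ) (P : Proc) : Proc :=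
  P.subst fun n => .name (f n)

end Proc

/-- Structural congruence. -/
inductive Cong : Proc → Proc → Prop
  | par_nil (P : Proc) : Cong (.par P .nil) P
  | par_comm (P Q : Proc) : Cong (.par P Q) (.par Q P)
  | par_assoc (P Q R : Proc) : Cong (.par P (.par Q R)) (.par (.par P Q) R)
  | res_nil : Cong (.res .nil) .nil
  | res_res (P : Proc) : Cong (.res (.res P)) (.res (.res (P.rename (Equiv.swap 0 1))))
  | repl_unfold (P : Proc) : Cong (.repl P) (.par P (.repl P))
  | par_res (P Q : Proc) : Cong (.par P (.res Q)) (.res (.par (P.rename (· + 1)) Q))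
  | refl (P : Proc) : Cong P P
  | symm {P Q : Proc} : Cong P Q → Cong Q P
  | trans {P Q R : Proc} : Cong P Q → Cong Q R → Cong P R
  | par {P P' Q Q' : Proc} : Cong P P' → Cong Q Q' → Cong (.par P Q) (.par P' Q')
  | repl {P P' : Proc} : Cong P P' → Cong (.repl P) (.repl P')
  | res {P P' : Proc} : Cong P P' → Cong (.res P) (.res P')
  | case (p : Pat) {P P' : Proc} : Cong P P' → Cong (.case p P) (.case p P')

/-- Reduction. -/
inductive Red : Proc → Proc → Prop
  | unify {p q : Pat} {σ ρ : List Comm} (P Q : Proc) : Unify p q σ ρ →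
      Red (.par (.case p P) (.case q Q)) (.par (P.subst (inst σ)) (Q.subst (inst ρ)))
  | par {P P' : Proc} (Q : Proc) : Red P P' → Red (.par P Q) (.par P' Q)
  | res {P P' : Proc} : Red P P' → Red (.res P) (.res P')
  | struct {P Q Q' P' : Proc} : Cong P Q → Red Q Q' → Cong Q' P' → Red P P'

/-- `P` can reduce to a process with an unguarded success process. -/
def Succeeds (P : Proc) : Prop :=
  ∃ P' P'', Relation.ReflTransGen Red P P' ∧ Cong P' (.par P'' .ok)

/-- `P` has an infinite sequence of reductions. -/
def Diverges (P : Proc) : Prop :=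
  ∃ f : ℕ → Proc, f 0 = P ∧ ∀ i, Red (f i) (f (i + 1))

/-- `P` exhibits the barb `m`: it is structurally congruent to a process `(ν ns)(p → P' | P'')`
with no protected name of `p` in `ns` and with `m = fn(p) \ ns`.  Here `ns` consists of `k` names,
which are the indices below `k`. -/
def Barb (P : Proc) (m : Set ℕ) : Prop :=
  ∃ (k : ℕ) (p : Pat) (P' P'' : Proc),
    Cong P (Proc.res^[k] (.par (.case p P') P'')) ∧ (∀ i ∈ p.pn, k ≤ i) ∧ m = {i | i + k ∈ p.fn}

/-- Terms with numbered holes and with chosen names for their binders; these names bind in what is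
put into the holes.  `case p xs _ C` is a case with the pattern `p` whose binding names, from left
to right, are called `xs` in the body `C` (the names in `p` itself lie outside their scope). -/
inductive Ctx : Type
  | hole (i : ℕ)
  | nil
  | ok
  | par (C D : Ctx)
  | repl (C : Ctx)
  | res (x : ℕ) (C : Ctx)
  | case (p : Pat) (xs : List ℕ) (h : xs.Nodup ∧ xs.length = p.binders) (C : Ctx)

namespace Ctx

/-- The holes of a term with holes, with multiplicity. -/
def holes : Ctx → Multiset ℕ
  | hole i => {i}
  | nil => 0
  | ok => 0
  | par C D => C.holes + D.holes
  | repl C => C.holes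
  | res _ C => C.holes
  | case _ _ _ C => C.holes

/-- `k`-ary contexts: each of the holes `0, ..., k - 1` occurs exactly once. -/
def IsContext (k : ℕ) (C : Ctx) : Prop :=
  C.holes = Multiset.range k

/-- Put processes literally into the holes; the binders of the context may capture their names. -/
def plug (S : ℕ → Proc) : Ctx → Proc
  | hole i => S i
  | nil => .nil
  | ok => .ok
  | par C D => .par (C.plug S) (D.plug S)
  | repl C => .repl (C.plug S)
  | res x C => .res ((C.plug S).rename (closeNames [x]))
  | case p xs _ C => .case p ((C.plug S).rename (closeNames xs))

end Ctx

/-- Barb preserving relations. -/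
def BarbPreserving (R : Proc → Proc → Prop) : Prop :=
  ∀ P Q m, R P Q → Barb P m → Barb Q m

/-- Reduction closed relations. -/
def ReductionClosed (R : Proc → Proc → Prop) : Prop :=
  ∀ P Q P', R P Q → Red P P' → ∃ Q', Red Q Q' ∧ R P' Q'

/-- Context closed relations. -/
def ContextClosed (R : Proc → Proc → Prop) : Prop :=
  ∀ P Q C, R P Q → Ctx.IsContext 1 C → R (C.plug fun _ => P) (C.plug fun _ => Q)

/-- Barbed congruence: the largest relation that is symmetric, barb preserving, reduction closed and
context closed. -/
def BarbedCong (P Q : Proc) : Prop :=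
  ∃ R : Proc → Proc → Prop,
    (∀ P Q, R P Q → R Q P) ∧ BarbPreserving R ∧ ReductionClosed R ∧ ContextClosed R ∧ R P Q

end CPC

/-! ### Spi calculus, with the success process -/

namespace Spi

/-- Terms.  A numeral `i > 0` is the `i`-th successor of zero.  Variables are names. -/
inductive Term : Type
  | name (n : ℕ)
  | pair (M N : Term)
  | zero
  | suc (M : Term)
  /-- The encryption of `M` under the key `N`. -/
  | encr (M N : Term)

namespace Term

/-- Substitution of terms for names. -/
def subst (f : ℕ → Term) : Term → Term
  | name n => f n
  | pair M N => pair (M.subst f) (N.subst f)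
  | zero => zero
  | suc M => suc (M.subst f)
  | encr M N => encr (M.subst f) (N.subst f)

/-- Substitution of names for names. -/
def rename (f : ℕ → ℕ) (M : Term) : Term :=
  M.subst fun n => name (f n)

/-- The names of a term. -/
def fn : Term → Set ℕ
  | name n => {n}
  | pair M N => M.fn ∪ N.fn
  | zero => ∅
  | suc M => M.fn
  | encr M N => M.fn ∪ N.fn

end Term

/-- Processes. -/
inductive Proc : Type
  | nil
  | ok
  | par (P Q : Proc)
  | repl (P : Proc)
  /-- Restriction; binds the index `0` in `P`. -/
  | res (P : Proc)
  /-- Input `M(x).P`; `x` is the index `0` in `P`. -/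
  | inp (M : Term) (P : Proc)
  /-- Output of `N` on `M`, then `P`. -/
  | out (M N : Term) (P : Proc)
  /-- The match `[M is N] P`. -/
  | test (M N : Term) (P : Proc)
  /-- The splitting `let (x, y) = M in P`; `x` and `y` are the indices `0` and `1` in `P`. -/
  | split (M : Term) (P : Proc)
  /-- The decryption `case M of {x}_N : P`; `x` is the index `0` in `P`. -/
  | decrypt (M N : Term) (P : Proc)
  /-- The integer test `case M of 0 : P suc(x) : Q`; `x` is the index `0` in `Q`. -/
  | intCase (M : Term) (P Q : Proc)

/-- The substitution `f`, moved under `k` binders. -/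
def liftSubst (k : ℕ) (f : ℕ → Term) (i : ℕ) : Term :=
  if i < k then .name i else (f (i - k)).rename (· + k)

/-- The substitution that replaces the bound indices `0, ..., σ.length - 1` by the values in `σ` and
removes their binders. -/
def inst (σ : List Term) (i : ℕ) : Term :=
  σ.getD i (.name (i - σ.length))

namespace Proc

/-- Capture-avoiding substitution. -/
def subst (f : ℕ → Term) : Proc → Proc
  | nil => nil
  | ok => ok
  | par P Q => par (P.subst f) (Q.subst f)
  | repl P => repl (P.subst f)
  | res P => res (P.subst (liftSubst 1 f))
  | inp M P => inp (M.subst f) (P.subst (liftSubst 1 f))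
  | out M N P => out (M.subst f) (N.subst f) (P.subst f)
  | test M N P => test (M.subst f) (N.subst f) (P.subst f)
  | split M P => split (M.subst f) (P.subst (liftSubst 2 f))
  | decrypt M N P => decrypt (M.subst f) (N.subst f) (P.subst (liftSubst 1 f))
  | intCase M P Q => intCase (M.subst f) (P.subst f) (Q.subst (liftSubst 1 f))

/-- Substitution of names for names. -/
def rename (f : ℕ → ℕ) (P : Proc) : Proc :=
  P.subst fun n => .name (f n)

/-- The free names of a process. -/
def fn : Proc → Set ℕ
  | nil => ∅
  | ok => ∅
  | par P Q => P.fn ∪ Q.fn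
  | repl P => P.fn
  | res P => {n | n + 1 ∈ P.fn}
  | inp M P => M.fn ∪ {n | n + 1 ∈ P.fn}
  | out M N P => M.fn ∪ N.fn ∪ P.fn
  | test M N P => M.fn ∪ N.fn ∪ P.fn
  | split M P => M.fn ∪ {n | n + 2 ∈ P.fn}
  | decrypt M N P => M.fn ∪ N.fn ∪ {n | n + 1 ∈ P.fn}
  | intCase M P Q => M.fn ∪ P.fn ∪ {n | n + 1 ∈ Q.fn}

end Proc

/-- Structural congruence. -/
inductive Cong : Proc → Proc → Prop
  | par_nil (P : Proc) : Cong (.par P .nil) P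
  | par_comm (P Q : Proc) : Cong (.par P Q) (.par Q P)
  | par_assoc (P Q R : Proc) : Cong (.par P (.par Q R)) (.par (.par P Q) R)
  | res_nil : Cong (.res .nil) .nil
  | res_res (P : Proc) : Cong (.res (.res P)) (.res (.res (P.rename (Equiv.swap 0 1))))
  | repl_unfold (P : Proc) : Cong (.repl P) (.par P (.repl P))
  | par_res (P Q : Proc) : Cong (.par P (.res Q)) (.res (.par (P.rename (· + 1)) Q))
  | refl (P : Proc) : Cong P P
  | symm {P Q : Proc} : Cong P Q → Cong Q P
  | trans {P Q R : Proc} : Cong P Q → Cong Q R → Cong P R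
  | par {P P' Q Q' : Proc} : Cong P P' → Cong Q Q' → Cong (.par P Q) (.par P' Q')
  | repl {P P' : Proc} : Cong P P' → Cong (.repl P) (.repl P')
  | res {P P' : Proc} : Cong P P' → Cong (.res P) (.res P')
  | inp (M : Term) {P P' : Proc} : Cong P P' → Cong (.inp M P) (.inp M P')
  | out (M N : Term) {P P' : Proc} : Cong P P' → Cong (.out M N P) (.out M N P')
  | test (M N : Term) {P P' : Proc} : Cong P P' → Cong (.test M N P) (.test M N P')
  | split (M : Term) {P P' : Proc} : Cong P P' → Cong (.split M P) (.split M P')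
  | decrypt (M N : Term) {P P' : Proc} : Cong P P' → Cong (.decrypt M N P) (.decrypt M N P')
  | intCase (M : Term) {P P' Q Q' : Proc} : Cong P P' → Cong Q Q' →
      Cong (.intCase M P Q) (.intCase M P' Q')

/-- Reduction. -/
inductive Red : Proc → Proc → Prop
  | comm (M N : Term) (P Q : Proc) :
      Red (.par (.out M N P) (.inp M Q)) (.par P (Q.subst (inst [N])))
  | test (M : Term) (P : Proc) : Red (.test M M P) P
  | split (M N : Term) (P : Proc) : Red (.split (.pair M N) P) (P.subst (inst [M, N]))
  | decrypt (M N : Term) (P : Proc) : Red (.decrypt (.encr M N) N P) (P.subst (inst [M]))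
  | intCase_zero (P Q : Proc) : Red (.intCase .zero P Q) P
  | intCase_suc (N : Term) (P Q : Proc) : Red (.intCase (.suc N) P Q) (Q.subst (inst [N]))
  | par {P P' : Proc} (Q : Proc) : Red P P' → Red (.par P Q) (.par P' Q)
  | res {P P' : Proc} : Red P P' → Red (.res P) (.res P')
  | struct {P Q Q' P' : Proc} : Cong P Q → Red Q Q' → Cong Q' P' → Red P P'

/-- `P` can reduce to a process with an unguarded success process. -/
def Succeeds (P : Proc) : Prop :=
  ∃ P' P'', Relation.ReflTransGen Red P P' ∧ Cong P' (.par P'' .ok)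

/-- `P` has an infinite sequence of reductions. -/
def Diverges (P : Proc) : Prop :=
  ∃ f : ℕ → Proc, f 0 = P ∧ ∀ i, Red (f i) (f (i + 1))

/-- The operators of the calculus, with their terms and with names for their binders. -/
inductive Op : Type
  | nil
  | ok
  | par
  | repl
  | res (m : ℕ)
  | inp (M : Term) (x : ℕ)
  | out (M N : Term)
  | test (M N : Term)
  | split (x y : ℕ) (h : x ≠ y) (M : Term)
  | decrypt (M : Term) (x : ℕ) (N : Term)
  | intCase (M : Term) (x : ℕ)

namespace Op

/-- The number of process arguments of an operator. -/
def arity : Op → ℕ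
  | nil => 0
  | ok => 0
  | par => 2
  | repl => 1
  | res _ => 1
  | inp _ _ => 1
  | out _ _ => 1
  | test _ _ => 1
  | split _ _ _ _ => 1
  | decrypt _ _ _ => 1
  | intCase _ _ => 2

/-- Application of an operator `op` to the arguments `S 0, ..., S (op.arity - 1)`. -/
def apply (S : ℕ → Proc) : Op → Proc
  | nil => .nil
  | ok => .ok
  | par => .par (S 0) (S 1)
  | repl => .repl (S 0)
  | res m => .res ((S 0).rename (closeNames [m]))
  | inp M x => .inp M ((S 0).rename (closeNames [x]))
  | out M N => .out M N (S 0)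
  | test M N => .test M N (S 0)
  | split x y _ M => .split M ((S 0).rename (closeNames [x, y]))
  | decrypt M x N => .decrypt M N ((S 0).rename (closeNames [x]))
  | intCase M x => .intCase M (S 0) ((S 1).rename (closeNames [x]))

end Op

end Spi

/-! ### Valid encodings of Spi calculus into CPC -/

/-- The translation `enc` with the renaming policy `φ`, which maps every Spi name to a tuple of `k`
CPC names, is a valid encoding. -/
structure IsValidEncoding (enc : Spi.Proc → CPC.Proc) {k : ℕ} (φ : ℕ → Fin k → ℕ) : Prop where
  tuple_pos : 0 < k
  compositionality : ∀ (op : Spi.Op) (N : Set ℕ), ∃ C : CPC.Ctx, C.IsContext op.arity ∧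
    ∀ S : ℕ → Spi.Proc, (⋃ i < op.arity, (S i).fn) = N →
      enc (op.apply S) = C.plug fun i => enc (S i)
  /-- `σ'` is the substitution of CPC names that corresponds to `σ` through the renaming policy; it
  does not touch the names that the renaming policy does not use. -/
  name_invariance : ∀ σ : ℕ → ℕ, ∃ σ' : ℕ → ℕ,
    (∀ a j, φ (σ a) j = σ' (φ a j)) ∧ (∀ c, (∀ a j, φ a j ≠ c) → σ' c = c) ∧
    ∀ S : Spi.Proc,
      (Function.Injective σ → enc (S.rename σ) = (enc S).rename σ') ∧
      (¬ Function.Injective σ → CPC.BarbedCong (enc (S.rename σ)) ((enc S).rename σ'))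
  operational_completeness : ∀ S S' : Spi.Proc, Relation.ReflTransGen Spi.Red S S' →
    ∃ T, Relation.ReflTransGen CPC.Red (enc S) T ∧ CPC.BarbedCong T (enc S')
  operational_soundness : ∀ (S : Spi.Proc) (T : CPC.Proc),
    Relation.ReflTransGen CPC.Red (enc S) T →
      ∃ (S' : Spi.Proc) (T' : CPC.Proc), Relation.ReflTransGen Spi.Red S S' ∧
        Relation.ReflTransGen CPC.Red T T' ∧ CPC.BarbedCong T' (enc S')
  divergence_reflection : ∀ S : Spi.Proc, CPC.Diverges (enc S) → Spi.Diverges S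
  success_sensitiveness : ∀ S : Spi.Proc, Spi.Succeeds S ↔ CPC.Succeeds (enc S)

/-! ### The encoding -/

/-- The reserved names used by the encoding. -/
inductive Tag : Type
  | pair
  | encr
  | zero
  | suc
  | input

namespace Spi

/-- The encoding of terms; `ι` gives the CPC names that stand for the Spi names and `τ` the CPC
names that are the reserved names. -/
def Term.encode (ι : ℕ → ℕ) (τ : Tag → ℕ) : Term → CPC.Comm
  | name n => .name (ι n)
  | pair M N => .comp (.comp (.name (τ .pair)) (M.encode ι τ)) (N.encode ι τ)
  | zero => .name (τ .zero)
  | suc M => .comp (.name (τ .suc)) (M.encode ι τ)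
  | encr M N => .comp (.comp (.name (τ .encr)) (M.encode ι τ)) (N.encode ι τ)

/-- The encoding of processes.  When it goes under `k` binders of CPC that do not bind anything in
the Spi process, the maps `ι` and `τ` are followed by `(· + k)`; for binders that bind in the Spi
process too, `ι` becomes `liftRenaming k ι`.

In the last four clauses the restriction introduces the fresh name `n`, which is the index `0` just
below it, and `ι₁` and `τ₁` are the maps for the scope of this restriction. -/
def Proc.encode (ι : ℕ → ℕ) (τ : Tag → ℕ) : Spi.Proc → CPC.Proc
  | .nil => .nil
  | .ok => .ok
  | .par P Q => .par (P.encode ι τ) (Q.encode ι τ)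
  | .repl P => .repl (P.encode ι τ)
  | .res P => .res (P.encode (liftRenaming 1 ι) (τ · + 1))
  | .inp M P =>
      .case (.comp (.comp (M.encode ι τ).toPat .bind) (.var (τ .input)))
        (P.encode (liftRenaming 1 ι) (τ · + 1))
  | .out M N P =>
      .case (.comp (.comp (M.encode ι τ).toPat (N.encode ι τ).toPat) .bind)
        (P.encode (ι · + 1) (τ · + 1))
  | .test M N P =>
      let ι₁ : ℕ → ℕ := (ι · + 1)
      let τ₁ : Tag → ℕ := (τ · + 1)
      .res (.par
        (.case (.comp (.prot 0) (M.encode ι₁ τ₁).toPat) (P.encode ι₁ τ₁))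
        (.case (.comp (.prot 0) (N.encode ι₁ τ₁).toPat) .nil))
  | .split M P =>
      let ι₁ : ℕ → ℕ := (ι · + 1)
      let τ₁ : Tag → ℕ := (τ · + 1)
      .res (.par
        (.case (.comp (.prot 0) (.comp (.comp (.prot (τ₁ .pair)) .bind) .bind))
          (P.encode (liftRenaming 2 ι₁) (τ₁ · + 2)))
        (.case (.comp (.prot 0) (M.encode ι₁ τ₁).toPat) .nil))
  | .decrypt M N P =>
      let ι₁ : ℕ → ℕ := (ι · + 1)
      let τ₁ : Tag → ℕ := (τ · + 1)
      .res (.par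
        (.case (.comp (.prot 0) (.comp (.comp (.prot (τ₁ .encr)) .bind) (N.encode ι₁ τ₁).toPat))
          (P.encode (liftRenaming 1 ι₁) (τ₁ · + 1)))
        (.case (.comp (.prot 0) (M.encode ι₁ τ₁).toPat) .nil))
  | .intCase M P Q =>
      let ι₁ : ℕ → ℕ := (ι · + 1)
      let τ₁ : Tag → ℕ := (τ · + 1)
      .res (.par
        (.case (.comp (.prot 0) (.prot (τ₁ .zero))) (P.encode ι₁ τ₁))
        (.par
          (.case (.comp (.prot 0) (.comp (.prot (τ₁ .suc)) .bind))
            (Q.encode (liftRenaming 1 ι₁) (τ₁ · + 1)))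
          (.case (.comp (.prot 0) (M.encode ι₁ τ₁).toPat) .nil)))

end Spi

/-!
Structural congruence of CPC is extended by one law, `GCong`: a case whose pattern demands a private
protected name that nobody else holds may be discarded.  Since only a pattern with the same
protected name unifies with such a pattern, and since the name is bound, the discarded case takes
part in no reduction and in no barb, so the extended congruence is contained in `BarbedCong`.
The encoding of an integer case leaves behind such a case, namely the branch that was not taken.

Reductions and barbs are read off from the unguarded threads of a process, up to the classes of the
extended congruence.  Injectivity of the encoding of terms shows that two threads of an encoding
interact precisely when the Spi process has the corresponding communication, test or
deconstruction.  Hence single reductions on the two sides match each other, and the rest of the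
operational claims follows by iteration.
-/

theorem liftRenaming_lt {k i : ℕ} (f : ℕ → ℕ) (h : i < k) : liftRenaming k f i = i := if_pos h

@[simp]
theorem liftRenaming_add (k i : ℕ) (f : ℕ → ℕ) : liftRenaming k f (i + k) = f i + k := by
  simp [liftRenaming]

theorem liftRenaming_zero (f : ℕ → ℕ) : liftRenaming 0 f = f := by
  funext i
  simp [liftRenaming]

theorem liftRenaming_liftRenaming (k l : ℕ) (f : ℕ → ℕ) :
    liftRenaming k (liftRenaming l f) = liftRenaming (k + l) f := by
  funext i
  have h : i - k - l = i - (k + l) := Nat.sub_sub i k l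
  simp only [liftRenaming, h]
  split_ifs <;> omega

theorem liftRenaming_injective {f : ℕ → ℕ} (k : ℕ) (hf : Function.Injective f) :
    Function.Injective (liftRenaming k f) := by
  intro i j h
  simp only [liftRenaming] at h
  split_ifs at h with hi hj hj
  · exact h
  · omega
  · omega
  · have := hf (Nat.add_right_cancel h)
    omega

theorem liftRenaming_comp_add (k : ℕ) (f : ℕ → ℕ) : liftRenaming k f ∘ (· + k) = (· + k) ∘ f := by
  funext i
  simp

theorem add_notMem_range_liftRenaming {f : ℕ → ℕ} {i : ℕ} (k : ℕ) (h : i ∉ Set.range f) :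
    i + k ∉ Set.range (liftRenaming k f) := by
  rintro ⟨j, hj⟩
  simp only [liftRenaming] at hj
  split_ifs at hj with hlt
  · omega
  · exact h ⟨_, Nat.add_right_cancel hj⟩

theorem swap_zero_one_involutive : Function.Involutive (Equiv.swap (0 : ℕ) 1) :=
  fun _ => Equiv.swap_apply_self _ _ _

theorem swap_zero_one_add_two (i : ℕ) : Equiv.swap (0 : ℕ) 1 (i + 2) = i + 2 :=
  Equiv.swap_apply_of_ne_of_ne (by omega) (by omega)

theorem swap_zero_one_liftRenaming_liftRenaming (f : ℕ → ℕ) (i : ℕ) :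
    Equiv.swap 0 1 (liftRenaming 1 (liftRenaming 1 f) i) =
      liftRenaming 1 (liftRenaming 1 f) (Equiv.swap 0 1 i) := by
  match i with
  | 0 => simp [liftRenaming]
  | 1 => simp [liftRenaming]
  | i + 2 =>
    rw [swap_zero_one_add_two, liftRenaming_liftRenaming, liftRenaming_add, swap_zero_one_add_two]

theorem swap_zero_one_comp_add_one :
    ⇑(Equiv.swap (0 : ℕ) 1) ∘ (· + 1) = liftRenaming 1 (· + 1) := by
  funext i
  rcases i with _ | i
  · simp [liftRenaming]
  · simp [liftRenaming, swap_zero_one_add_two]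

theorem swap_zero_one_comp_liftRenaming :
    ⇑(Equiv.swap (0 : ℕ) 1) ∘ liftRenaming 1 (· + 1) = (· + 1) := by
  rw [← swap_zero_one_comp_add_one, ← Function.comp_assoc, swap_zero_one_involutive.comp_self,
    Function.id_comp]

namespace CPC

/-! ### Substitution in CPC -/

namespace Comm

/-- Substitution in communicable patterns, the restriction of `Pat.subst`. -/
def subst (f : ℕ → Comm) : Comm → Comm
  | name n => f n
  | comp c d => comp (c.subst f) (d.subst f)

theorem rename_eq_subst (f : ℕ → ℕ) (c : Comm) : c.rename f = c.subst fun n => name (f n) := by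
  induction c with
  | name n => rfl
  | comp c d hc hd => simp [rename, subst, hc, hd]

theorem subst_subst (f g : ℕ → Comm) (c : Comm) :
    (c.subst f).subst g = c.subst fun i => (f i).subst g := by
  induction c with
  | name n => rfl
  | comp c d hc hd => simp [subst, hc, hd]

theorem subst_name (c : Comm) : c.subst name = c := by
  induction c with
  | name n => rfl
  | comp c d hc hd => simp [subst, hc, hd]

theorem subst_toPat (f : ℕ → Comm) (c : Comm) : c.toPat.subst f = (c.subst f).toPat := by
  induction c with
  | name n => rfl
  | comp c d hc hd => simp [subst, toPat, Pat.subst, hc, hd]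

theorem subst_protect (f : ℕ → Comm) (c : Comm) : c.protect.subst f = (c.subst f).protect := by
  induction c with
  | name n => rfl
  | comp c d hc hd => simp [subst, protect, Pat.subst, hc, hd]

@[simp]
theorem binders_toPat (c : Comm) : c.toPat.binders = 0 := by
  induction c with
  | name n => rfl
  | comp c d hc hd => simp [toPat, Pat.binders, hc, hd]

@[simp]
theorem binders_protect (c : Comm) : c.protect.binders = 0 := by
  induction c with
  | name n => rfl
  | comp c d hc hd => simp [protect, Pat.binders, hc, hd]

theorem toPat_injective : Function.Injective toPat := by
  intro c
  induction c with
  | name n => intro d h; cases d <;> simp_all [toPat]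
  | comp c d hc hd =>
    intro e h
    cases e with
    | name n => simp [toPat] at h
    | comp e e' =>
      simp only [toPat, Pat.comp.injEq] at h
      rw [hc h.1, hd h.2]

end Comm

namespace Pat

@[simp]
theorem binders_subst (f : ℕ → Comm) (p : Pat) : (p.subst f).binders = p.binders := by
  induction p with
  | bind => rfl
  | var n => simp [subst, binders]
  | prot n => simp [subst, binders]
  | comp p q hp hq => simp [subst, binders, hp, hq]

theorem subst_subst (f g : ℕ → Comm) (p : Pat) :
    (p.subst f).subst g = p.subst fun i => (f i).subst g := by
  induction p with
  | bind => rfl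
  | var n => exact Comm.subst_toPat g _
  | prot n => exact Comm.subst_protect g _
  | comp p q hp hq => simp [subst, hp, hq]

theorem subst_name (p : Pat) : p.subst Comm.name = p := by
  induction p with
  | bind => rfl
  | var n => rfl
  | prot n => rfl
  | comp p q hp hq => simp [subst, hp, hq]

/-- Substitution of names for the free names of a pattern. -/
abbrev rename (f : ℕ → ℕ) (p : Pat) : Pat := p.subst fun n => .name (f n)

theorem fn_rename (f : ℕ → ℕ) (p : Pat) : (p.rename f).fn = f '' p.fn := by
  induction p with
  | bind => simp [rename, subst, fn]
  | var n => simp [rename, subst, fn, Comm.toPat]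
  | prot n => simp [rename, subst, fn, Comm.protect]
  | comp p q hp hq => simp only [rename, subst, fn, Set.image_union] at *; rw [hp, hq]

theorem pn_rename (f : ℕ → ℕ) (p : Pat) : (p.rename f).pn = f '' p.pn := by
  induction p with
  | bind => simp [rename, subst, pn]
  | var n => simp [rename, subst, pn, Comm.toPat]
  | prot n => simp [rename, subst, pn, Comm.protect]
  | comp p q hp hq => simp only [rename, subst, pn, Set.image_union] at *; rw [hp, hq]

@[simp]
theorem rename_eq_bind {f : ℕ → ℕ} {p : Pat} : p.rename f = bind ↔ p = bind := by
  cases p <;> simp [rename, subst, Comm.toPat, Comm.protect]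

@[simp]
theorem rename_eq_var {f : ℕ → ℕ} {p : Pat} {n : ℕ} :
    p.rename f = var n ↔ ∃ m, p = var m ∧ f m = n := by
  cases p <;> simp [rename, subst, Comm.toPat, Comm.protect]

@[simp]
theorem rename_eq_prot {f : ℕ → ℕ} {p : Pat} {n : ℕ} :
    p.rename f = prot n ↔ ∃ m, p = prot m ∧ f m = n := by
  cases p <;> simp [rename, subst, Comm.toPat, Comm.protect]

@[simp]
theorem rename_eq_comp {f : ℕ → ℕ} {p q r : Pat} :
    p.rename f = comp q r ↔ ∃ q' r', p = comp q' r' ∧ q'.rename f = q ∧ r'.rename f = r := by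
  cases p <;> simp [rename, subst, Comm.toPat, Comm.protect]

theorem exists_of_rename_eq_toPat {f : ℕ → ℕ} {p : Pat} {c : Comm} (h : p.rename f = c.toPat) :
    ∃ d : Comm, p = d.toPat ∧ c = d.rename f := by
  induction c generalizing p with
  | name n =>
    obtain ⟨m, rfl, rfl⟩ := rename_eq_var.1 h
    exact ⟨.name m, rfl, rfl⟩
  | comp c d hc hd =>
    obtain ⟨p, q, rfl, hp, hq⟩ := rename_eq_comp.1 h
    obtain ⟨c', rfl, rfl⟩ := hc hp
    obtain ⟨d', rfl, rfl⟩ := hd hq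
    exact ⟨.comp c' d', rfl, rfl⟩

end Pat

theorem liftSubst_lt {k i : ℕ} (f : ℕ → Comm) (h : i < k) : liftSubst k f i = .name i := if_pos h

@[simp]
theorem liftSubst_add (k i : ℕ) (f : ℕ → Comm) : liftSubst k f (i + k) = (f i).rename (· + k) := by
  simp [liftSubst]

theorem liftSubst_zero (f : ℕ → Comm) : liftSubst 0 f = f := by
  funext i
  exact (Comm.rename_eq_subst _ (f i)).trans (f i).subst_name

theorem liftSubst_name (k : ℕ) (f : ℕ → ℕ) :
    (liftSubst k fun n => .name (f n)) = fun n => .name (liftRenaming k f n) := by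
  funext i
  simp only [liftSubst, liftRenaming]
  split_ifs <;> rfl

theorem liftSubst_id (k : ℕ) : liftSubst k Comm.name = Comm.name := by
  funext i
  simp only [liftSubst, Comm.rename]
  split_ifs with h
  · rfl
  · rw [Nat.sub_add_cancel (not_lt.1 h)]

theorem subst_liftSubst_liftSubst (k : ℕ) (f g : ℕ → Comm) :
    (fun i => (liftSubst k f i).subst (liftSubst k g)) = liftSubst k fun i => (f i).subst g := by
  funext i
  rcases lt_or_ge i k with h | h
  · simp [liftSubst_lt _ h, Comm.subst]
  · obtain ⟨j, rfl⟩ := Nat.exists_eq_add_of_le' h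
    simp [Comm.rename_eq_subst, Comm.subst_subst, Comm.subst]

namespace Proc

theorem subst_subst (f g : ℕ → Comm) (P : Proc) :
    (P.subst f).subst g = P.subst fun i => (f i).subst g := by
  induction P generalizing f g with
  | nil => rfl
  | ok => rfl
  | par P Q hP hQ => simp [subst, hP, hQ]
  | repl P hP => simp [subst, hP]
  | res P hP => simp [subst, hP, subst_liftSubst_liftSubst]
  | case p P hP => simp [subst, hP, subst_liftSubst_liftSubst, Pat.subst_subst]

theorem subst_name (P : Proc) : P.subst Comm.name = P := by
  induction P with
  | nil => rfl
  | ok => rfl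
  | par P Q hP hQ => simp [subst, hP, hQ]
  | repl P hP => simp [subst, hP]
  | res P hP => simp [subst, hP, liftSubst_id]
  | case p P hP => simp [subst, hP, liftSubst_id, Pat.subst_name]

@[simp]
theorem rename_nil (f : ℕ → ℕ) : nil.rename f = nil := rfl

@[simp]
theorem rename_par (f : ℕ → ℕ) (P Q : Proc) :
    (par P Q).rename f = par (P.rename f) (Q.rename f) := rfl

@[simp]
theorem rename_res (f : ℕ → ℕ) (P : Proc) :
    (res P).rename f = res (P.rename (liftRenaming 1 f)) := by
  simp [rename, subst, liftSubst_name]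

@[simp]
theorem rename_case (f : ℕ → ℕ) (p : Pat) (P : Proc) :
    (case p P).rename f = case (p.rename f) (P.rename (liftRenaming p.binders f)) := by
  simp [rename, subst, liftSubst_name]

theorem rename_eq_case {f : ℕ → ℕ} {P : Proc} {p : Pat} {A : Proc} :
    P.rename f = case p A ↔
      ∃ q B, P = case q B ∧ q.rename f = p ∧ B.rename (liftRenaming q.binders f) = A := by
  cases P <;> simp [rename, subst, liftSubst_name]

theorem rename_rename (f g : ℕ → ℕ) (P : Proc) : (P.rename f).rename g = P.rename (g ∘ f) := by
  simp only [rename, subst_subst]; rfl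

theorem rename_id (P : Proc) : P.rename id = P := subst_name P

theorem subst_rename_add (k : ℕ) (f : ℕ → Comm) (P : Proc) :
    (P.rename (· + k)).subst (liftSubst k f) = (P.subst f).rename (· + k) := by
  simp only [rename, subst_subst]
  congr 1
  funext i
  simp [Comm.subst, Comm.rename_eq_subst]

theorem subst_rename_swap (f : ℕ → Comm) (P : Proc) :
    (P.rename (Equiv.swap 0 1)).subst (liftSubst 1 (liftSubst 1 f)) =
      (P.subst (liftSubst 1 (liftSubst 1 f))).rename (Equiv.swap 0 1) := by
  simp only [rename, subst_subst]
  congr 1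
  funext i
  rcases i with _ | _ | i
  · simp [Comm.subst, liftSubst, Comm.rename]
  · simp [Comm.subst, liftSubst, Comm.rename]
  · simp only [Comm.subst, swap_zero_one_add_two]
    rw [show i + 2 = i + 1 + 1 from rfl, liftSubst_add, liftSubst_add]
    simp only [Comm.rename_eq_subst, Comm.subst_subst, Comm.subst]
    exact congrArg (Comm.subst · _) (funext fun j => congrArg _ (swap_zero_one_add_two j).symm)

theorem rename_swap_rename_swap (P : Proc) :
    (P.rename (Equiv.swap 0 1)).rename (Equiv.swap 0 1) = P := by
  rw [rename_rename, swap_zero_one_involutive.comp_self, rename_id]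

theorem rename_subst_inst (f : ℕ → ℕ) (σ : List Comm) (P : Proc) :
    (P.subst (inst σ)).rename f =
      (P.rename (liftRenaming σ.length f)).subst (inst (σ.map (Comm.rename f))) := by
  simp only [rename, subst_subst]
  congr 1
  funext i
  simp only [Comm.subst, inst, liftRenaming, List.length_map]
  split_ifs with h
  · simp [h, Comm.rename_eq_subst]
  · simp [not_lt.1 h, Comm.subst]

end Proc

/-! ### Unification -/

namespace Unify

theorem symm {p q : Pat} {σ ρ : List Comm} (h : Unify p q σ ρ) : Unify q p ρ σ := by
  induction h with
  | var_var n => exact .var_var n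
  | var_prot n => exact .prot_var n
  | prot_var n => exact .var_prot n
  | prot_prot n => exact .prot_prot n
  | bind_left q c h => exact .bind_right q c h
  | bind_right p c h => exact .bind_left p c h
  | comp _ _ h₁ h₂ => exact .comp h₁ h₂

theorem length_left {p q : Pat} {σ ρ : List Comm} (h : Unify p q σ ρ) : σ.length = p.binders := by
  induction h with
  | bind_right p c h => simp [h]
  | comp _ _ h₁ h₂ => simp [Pat.binders, h₁, h₂]
  | _ => rfl

theorem length_right {p q : Pat} {σ ρ : List Comm} (h : Unify p q σ ρ) : ρ.length = q.binders :=
  h.symm.length_left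

theorem rename (f : ℕ → ℕ) {p q : Pat} {σ ρ : List Comm} (h : Unify p q σ ρ) :
    Unify (p.rename f) (q.rename f) (σ.map (Comm.rename f)) (ρ.map (Comm.rename f)) := by
  induction h with
  | var_var n => exact .var_var _
  | var_prot n => exact .var_prot _
  | prot_var n => exact .prot_var _
  | prot_prot n => exact .prot_prot _
  | bind_left q c h =>
    exact .bind_left _ _ (by rw [h, Comm.rename_eq_subst]; exact Comm.subst_toPat _ _)
  | bind_right p c h =>
    exact .bind_right _ _ (by rw [h, Comm.rename_eq_subst]; exact Comm.subst_toPat _ _)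
  | comp _ _ h₁ h₂ => rw [List.map_append, List.map_append]; exact .comp h₁ h₂

theorem of_rename {f : ℕ → ℕ} (hf : Function.Injective f) {p q : Pat} {σ' ρ' : List Comm}
    (h : Unify (p.rename f) (q.rename f) σ' ρ') :
    ∃ σ ρ, Unify p q σ ρ ∧ σ' = σ.map (Comm.rename f) ∧ ρ' = ρ.map (Comm.rename f) := by
  generalize hp : p.rename f = p' at h
  generalize hq : q.rename f = q' at h
  induction h generalizing p q with
  | bind_left _ c h =>
    obtain rfl := Pat.rename_eq_bind.1 hp
    obtain ⟨d, rfl, rfl⟩ := Pat.exists_of_rename_eq_toPat (hq.trans h)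
    exact ⟨[d], [], .bind_left _ _ rfl, rfl, rfl⟩
  | bind_right _ c h =>
    obtain rfl := Pat.rename_eq_bind.1 hq
    obtain ⟨d, rfl, rfl⟩ := Pat.exists_of_rename_eq_toPat (hp.trans h)
    exact ⟨[], [d], .bind_right _ _ rfl, rfl, rfl⟩
  | comp _ _ h₁ h₂ =>
    obtain ⟨p₁, p₂, rfl, hp₁, hp₂⟩ := Pat.rename_eq_comp.1 hp
    obtain ⟨q₁, q₂, rfl, hq₁, hq₂⟩ := Pat.rename_eq_comp.1 hq
    obtain ⟨σ₁, ρ₁, h₁', rfl, rfl⟩ := h₁ hp₁ hq₁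
    obtain ⟨σ₂, ρ₂, h₂', rfl, rfl⟩ := h₂ hp₂ hq₂
    exact ⟨_, _, .comp h₁' h₂', by rw [List.map_append], by rw [List.map_append]⟩
  | _ n =>
    simp only [Pat.rename_eq_var, Pat.rename_eq_prot] at hp hq
    obtain ⟨m, rfl, hm⟩ := hp
    obtain ⟨m', rfl, hm'⟩ := hq
    obtain rfl := hf (hm.trans hm'.symm)
    exact ⟨[], [], by constructor, rfl, rfl⟩

theorem exists_of_prot_comp {p r : Pat} {i : ℕ} {σ ρ : List Comm}
    (h : Unify r (.comp (.prot i) p) σ ρ) :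
    ∃ q s, r = .comp q s ∧ (q = .var i ∨ q = .prot i) := by
  cases h with
  | bind_left _ c h =>
    cases c with
    | name n => cases h
    | comp c d => cases c <;> cases h
  | comp h₁ _ =>
    cases h₁ with
    | bind_left _ c h => cases c <;> cases h
    | var_prot => exact ⟨_, _, rfl, .inl rfl⟩
    | prot_prot => exact ⟨_, _, rfl, .inr rfl⟩

theorem not_comp_prot {f : ℕ → ℕ} {i : ℕ} (hi : i ∉ Set.range f) {p q : Pat} {σ ρ : List Comm} :
    ¬ Unify (q.rename f) (.comp (.prot i) p) σ ρ := by
  intro h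
  obtain ⟨q₁, q₂, hq, hi' | hi'⟩ := h.exists_of_prot_comp <;>
  · obtain ⟨r₁, r₂, rfl, hr, -⟩ := Pat.rename_eq_comp.1 hq
    simp only [hi', Pat.rename_eq_var, Pat.rename_eq_prot] at hr
    obtain ⟨n, -, rfl⟩ := hr
    exact hi ⟨n, rfl⟩

theorem toPat_iff {c d : Comm} {σ ρ : List Comm} :
    Unify c.toPat d.toPat σ ρ ↔ c = d ∧ σ = [] ∧ ρ = [] := by
  constructor
  · intro h
    induction c generalizing d σ ρ with
    | name n => cases d <;> cases h; exact ⟨rfl, rfl, rfl⟩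
    | comp c c' hc hc' =>
      cases d with
      | name n => cases h
      | comp d d' =>
        cases h with
        | comp h₁ h₂ =>
          obtain ⟨rfl, rfl, rfl⟩ := hc h₁
          obtain ⟨rfl, rfl, rfl⟩ := hc' h₂
          exact ⟨rfl, rfl, rfl⟩
  · rintro ⟨rfl, rfl, rfl⟩
    induction c with
    | name n => exact .var_var n
    | comp c d hc hd => exact .comp hc hd

end Unify

end CPC

namespace CPC

/-! ### Structural congruence with garbage collection -/

/-- The laws of structural congruence, read from left to right.  If `g` holds, they include the
law `dead` of garbage collection: a case whose pattern protects a private name is blocked. -/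
inductive Law (g : Prop) : Proc → Proc → Prop
  | par_nil (P : Proc) : Law g (.par P .nil) P
  | par_comm (P Q : Proc) : Law g (.par P Q) (.par Q P)
  | par_assoc (P Q R : Proc) : Law g (.par P (.par Q R)) (.par (.par P Q) R)
  | res_nil : Law g (.res .nil) .nil
  | res_res (P : Proc) : Law g (.res (.res P)) (.res (.res (P.rename (Equiv.swap 0 1))))
  | repl_unfold (P : Proc) : Law g (.repl P) (.par P (.repl P))
  | par_res (P Q : Proc) : Law g (.par P (.res Q)) (.res (.par (P.rename (· + 1)) Q))
  | dead (hg : g) (p : Pat) (P : Proc) : Law g (.res (.case (.comp (.prot 0) p) P)) .nil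

/-- The congruence generated by `Law g`.  It is structural congruence for `g = False`, and
structural congruence with garbage collection for `g = True`.  Having both directions of the laws
as constructors instead of symmetry lets one prove invariance properties by induction in one
direction only. -/
inductive GCong (g : Prop) : Proc → Proc → Prop
  | law {P Q : Proc} : Law g P Q → GCong g P Q
  | law_symm {P Q : Proc} : Law g P Q → GCong g Q P
  | refl (P : Proc) : GCong g P P
  | trans {P Q R : Proc} : GCong g P Q → GCong g Q R → GCong g P R
  | par {P P' Q Q' : Proc} : GCong g P P' → GCong g Q Q' → GCong g (.par P Q) (.par P' Q')
  | repl {P P' : Proc} : GCong g P P' → GCong g (.repl P) (.repl P')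
  | res {P P' : Proc} : GCong g P P' → GCong g (.res P) (.res P')
  | case (p : Pat) {P P' : Proc} : GCong g P P' → GCong g (.case p P) (.case p P')

variable {g : Prop}

theorem Law.subst {P Q : Proc} (h : Law g P Q) (f : ℕ → Comm) :
    Law g (P.subst f) (Q.subst f) := by
  cases h with
  | res_res P => simpa only [Proc.subst, Proc.subst_rename_swap] using .res_res _
  | par_res P Q => simpa only [Proc.subst, Proc.subst_rename_add] using .par_res _ _
  | dead hg p P => exact .dead hg _ _
  | _ => constructor

theorem Law.cong {P Q : Proc} (h : Law False P Q) : Cong P Q := by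
  cases h with
  | dead hg p P => exact hg.elim
  | _ => constructor

namespace GCong

theorem symm {P Q : Proc} (h : GCong g P Q) : GCong g Q P := by
  induction h with
  | law h => exact .law_symm h
  | law_symm h => exact .law h
  | refl P => exact .refl P
  | trans _ _ ih₁ ih₂ => exact ih₂.trans ih₁
  | par _ _ ih₁ ih₂ => exact ih₁.par ih₂
  | repl _ ih => exact ih.repl
  | res _ ih => exact ih.res
  | case p _ ih => exact ih.case p

theorem subst {P Q : Proc} (h : GCong g P Q) (f : ℕ → Comm) :
    GCong g (P.subst f) (Q.subst f) := by
  induction h generalizing f with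
  | law h => exact .law (h.subst f)
  | law_symm h => exact .law_symm (h.subst f)
  | refl P => exact .refl _
  | trans _ _ ih₁ ih₂ => exact (ih₁ f).trans (ih₂ f)
  | par _ _ ih₁ ih₂ => exact (ih₁ f).par (ih₂ f)
  | repl _ ih => exact (ih f).repl
  | res _ ih => exact (ih _).res
  | case p _ ih => exact (ih _).case _

theorem rename {P Q : Proc} (h : GCong g P Q) (f : ℕ → ℕ) :
    GCong g (P.rename f) (Q.rename f) :=
  h.subst _

end GCong

theorem Cong.gcong {P Q : Proc} (g : Prop) (h : Cong P Q) : GCong g P Q := by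
  induction h with
  | refl P => exact .refl P
  | symm _ ih => exact ih.symm
  | trans _ _ ih₁ ih₂ => exact ih₁.trans ih₂
  | par _ _ ih₁ ih₂ => exact ih₁.par ih₂
  | repl _ ih => exact ih.repl
  | res _ ih => exact ih.res
  | case p _ ih => exact ih.case p
  | _ => exact .law (by constructor)

theorem GCong.cong {P Q : Proc} (h : GCong False P Q) : Cong P Q := by
  induction h with
  | law h => exact h.cong
  | law_symm h => exact h.cong.symm
  | refl P => exact .refl P
  | trans _ _ ih₁ ih₂ => exact ih₁.trans ih₂
  | par _ _ ih₁ ih₂ => exact ih₁.par ih₂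
  | repl _ ih => exact ih.repl
  | res _ ih => exact ih.res
  | case p _ ih => exact ih.case p

/-- The setoid of the congruence `GCong g`. -/
def gcongSetoid (g : Prop) : Setoid Proc := ⟨GCong g, .refl, .symm, .trans⟩

/-- Processes up to `GCong g`, a commutative monoid under parallel composition. -/
def GClass (g : Prop) : Type := Quotient (gcongSetoid g)

/-- The class of a process. -/
def cls (g : Prop) (P : Proc) : GClass g := Quotient.mk (gcongSetoid g) P

theorem cls_eq_cls {P Q : Proc} : cls g P = cls g Q ↔ GCong g P Q :=
  ⟨fun h => Quotient.exact (s := gcongSetoid g) h, fun h => Quotient.sound (s := gcongSetoid g) h⟩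

theorem GCong.cls_eq {P Q : Proc} (h : GCong g P Q) : cls g P = cls g Q := cls_eq_cls.2 h

theorem exists_cls_eq (c : GClass g) : ∃ P, cls g P = c := Quotient.exists_rep c

namespace GClass

/-- Restriction of classes. -/
def res : GClass g → GClass g :=
  Quotient.map' (s₁ := gcongSetoid g) (s₂ := gcongSetoid g) Proc.res fun _ _ h => h.res

/-- Replication of classes. -/
def repl : GClass g → GClass g :=
  Quotient.map' (s₁ := gcongSetoid g) (s₂ := gcongSetoid g) Proc.repl fun _ _ h => h.repl

/-- Renaming of classes. -/
def rename (f : ℕ → ℕ) : GClass g → GClass g :=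
  Quotient.map' (s₁ := gcongSetoid g) (s₂ := gcongSetoid g) (Proc.rename f) fun _ _ h => h.rename f

instance : CommMonoid (GClass g) where
  mul := Quotient.map₂ (sa := gcongSetoid g) (sb := gcongSetoid g) (sc := gcongSetoid g) Proc.par
    fun _ _ h _ _ h' => h.par h'
  one := cls g .nil
  mul_assoc := by
    rintro ⟨P⟩ ⟨Q⟩ ⟨R⟩
    exact (GCong.law_symm (.par_assoc P Q R)).cls_eq
  one_mul := by
    rintro ⟨P⟩
    exact ((GCong.law (.par_comm _ P)).trans (.law (.par_nil P))).cls_eq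
  mul_one := by
    rintro ⟨P⟩
    exact (GCong.law (.par_nil P)).cls_eq
  mul_comm := by
    rintro ⟨P⟩ ⟨Q⟩
    exact (GCong.law (.par_comm P Q)).cls_eq

end GClass

@[simp]
theorem cls_par (P Q : Proc) : cls g (.par P Q) = cls g P * cls g Q := rfl

@[simp]
theorem cls_nil : cls g .nil = 1 := rfl

@[simp]
theorem cls_res (P : Proc) : cls g (.res P) = (cls g P).res := rfl

@[simp]
theorem cls_repl (P : Proc) : cls g (.repl P) = (cls g P).repl := rfl

@[simp]
theorem cls_rename (f : ℕ → ℕ) (P : Proc) : cls g (P.rename f) = (cls g P).rename f := rfl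

theorem cls_res_dead (hg : g) (p : Pat) (P : Proc) :
    (cls g (.case (.comp (.prot 0) p) P)).res = 1 :=
  (GCong.law (.dead hg p P)).cls_eq

namespace GClass

@[simp]
theorem res_one : (1 : GClass g).res = 1 := (GCong.law .res_nil).cls_eq

@[simp]
theorem rename_one (f : ℕ → ℕ) : (1 : GClass g).rename f = 1 := rfl

@[simp]
theorem rename_mul (f : ℕ → ℕ) (c d : GClass g) :
    (c * d).rename f = c.rename f * d.rename f := by
  obtain ⟨P, rfl⟩ := exists_cls_eq c
  obtain ⟨Q, rfl⟩ := exists_cls_eq d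
  rfl

@[simp]
theorem rename_res (f : ℕ → ℕ) (c : GClass g) :
    c.res.rename f = (c.rename (liftRenaming 1 f)).res := by
  obtain ⟨P, rfl⟩ := exists_cls_eq c
  rw [← cls_res, ← cls_rename, Proc.rename_res, cls_res, cls_rename]

theorem repl_eq_mul_repl (c : GClass g) : c.repl = c * c.repl := by
  obtain ⟨P, rfl⟩ := exists_cls_eq c
  exact (GCong.law (.repl_unfold P)).cls_eq

theorem res_rename_mul (c d : GClass g) : (c.rename (· + 1) * d).res = c * d.res := by
  obtain ⟨P, rfl⟩ := exists_cls_eq c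
  obtain ⟨Q, rfl⟩ := exists_cls_eq d
  exact (GCong.law_symm (.par_res P Q)).cls_eq

theorem res_mul_rename (c d : GClass g) : (c * d.rename (· + 1)).res = c.res * d := by
  rw [mul_comm, res_rename_mul, mul_comm]

theorem res_res_rename_swap (c : GClass g) : (c.rename (Equiv.swap 0 1)).res.res = c.res.res := by
  obtain ⟨P, rfl⟩ := exists_cls_eq c
  exact (GCong.law_symm (.res_res P)).cls_eq

end GClass

/-! ### Exposed threads -/

/-- A process `P` exposes a thread (a case or the success process) to an environment `e`.  The base
relation `K` tells what the thread becomes in presence of `e`, and the last argument is what `P`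
becomes then.  On the way from `P` to the thread, `e` is renamed below every restriction. -/
inductive Expose {E : Type} (ren : (ℕ → ℕ) → E → E) (K : E → Proc → GClass g → Prop) :
    E → Proc → GClass g → Prop
  | ok {e : E} {c : GClass g} : K e .ok c → Expose ren K e .ok c
  | case {e : E} {p : Pat} {P : Proc} {c : GClass g} :
      K e (.case p P) c → Expose ren K e (.case p P) c
  | parL {e : E} {P : Proc} {c : GClass g} (Q : Proc) :
      Expose ren K e P c → Expose ren K e (.par P Q) (c * cls g Q)
  | parR {e : E} (P : Proc) {Q : Proc} {c : GClass g} :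
      Expose ren K e Q c → Expose ren K e (.par P Q) (cls g P * c)
  | repl {e : E} {P : Proc} {c : GClass g} :
      Expose ren K e P c → Expose ren K e (.repl P) (c * cls g (.repl P))
  | res {e : E} {P : Proc} {c : GClass g} :
      Expose ren K (ren (· + 1) e) P c → Expose ren K e (.res P) c.res

/-- A frame rule: `Φ e e' s` says that passing from the environment `e` to `e'` adds `s` to the
outcome. -/
theorem Expose.frame {E E' : Type} {ren : (ℕ → ℕ) → E → E} {ren' : (ℕ → ℕ) → E' → E'}
    {K : E → Proc → GClass g → Prop} {K' : E' → Proc → GClass g → Prop}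
    {Φ : E → E' → GClass g → Prop}
    (hren : ∀ {e e' s}, Φ e e' s → Φ (ren (· + 1) e) (ren' (· + 1) e') (s.rename (· + 1)))
    (hK : ∀ {e e' s T c}, Φ e e' s → K e T c → K' e' T (c * s))
    {e : E} {e' : E'} {P : Proc} {c s : GClass g} (hΦ : Φ e e' s) (h : Expose ren K e P c) :
    Expose ren' K' e' P (c * s) := by
  induction h generalizing e' s with
  | ok h => exact .ok (hK hΦ h)
  | case h => exact .case (hK hΦ h)
  | parL Q _ ih => simpa only [mul_right_comm] using (ih hΦ).parL Q
  | parR P _ ih => simpa only [mul_assoc] using (ih hΦ).parR P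
  | repl _ ih => simpa only [mul_right_comm] using (ih hΦ).repl
  | res _ ih => simpa only [GClass.res_mul_rename] using (ih (hren hΦ)).res

/-- Base relations that respect congruence and injective renaming and to which blocked cases are
invisible. -/
structure IsObservation {E : Type} (ren : (ℕ → ℕ) → E → E) (K : E → Proc → GClass g → Prop) :
    Prop where
  ren_ren : ∀ f h e, ren h (ren f e) = ren (h ∘ f) e
  gcong : ∀ {e p A B c}, GCong g A B → K e (.case p A) c → K e (.case p B) c
  rename : ∀ {f e T c}, Function.Injective f → K e T c → K (ren f e) (T.rename f) (c.rename f)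
  of_rename : ∀ {f e T c'}, Function.Injective f → K (ren f e) (T.rename f) c' →
    ∃ c, c' = c.rename f ∧ K e T c
  not_dead : ∀ {e p A c}, ¬ K (ren (· + 1) e) (.case (.comp (.prot 0) p) A) c

namespace IsObservation

variable {E : Type} {ren : (ℕ → ℕ) → E → E} {K : E → Proc → GClass g → Prop}

theorem ren_add_one (hK : IsObservation ren K) (f : ℕ → ℕ) (e : E) :
    ren (· + 1) (ren f e) = ren (liftRenaming 1 f) (ren (· + 1) e) := by
  rw [hK.ren_ren, hK.ren_ren, liftRenaming_comp_add]

theorem expose_rename (hK : IsObservation ren K) {f : ℕ → ℕ} (hf : Function.Injective f) {e : E}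
    {P : Proc} {c : GClass g} (h : Expose ren K e P c) :
    Expose ren K (ren f e) (P.rename f) (c.rename f) := by
  induction h generalizing f with
  | ok h => exact .ok (hK.rename hf h)
  | case h =>
    have := hK.rename hf h
    rw [Proc.rename_case] at this ⊢
    exact .case this
  | parL Q _ ih =>
    rw [GClass.rename_mul]
    exact (ih hf).parL (Q.rename f)
  | parR P _ ih =>
    rw [GClass.rename_mul]
    exact (ih hf).parR (P.rename f)
  | repl _ ih =>
    rw [GClass.rename_mul]
    exact (ih hf).repl
  | res _ ih =>
    have := ih (liftRenaming_injective 1 hf)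
    rw [← hK.ren_add_one] at this
    rw [Proc.rename_res, GClass.rename_res]
    exact this.res

theorem expose_of_rename (hK : IsObservation ren K) {f : ℕ → ℕ} (hf : Function.Injective f) {e : E}
    {P : Proc} {c' : GClass g} (h : Expose ren K (ren f e) (P.rename f) c') :
    ∃ c, c' = c.rename f ∧ Expose ren K e P c := by
  induction P generalizing f e c' with
  | nil => cases h
  | ok =>
    cases h with
    | ok h =>
      obtain ⟨c, rfl, h'⟩ := hK.of_rename (T := .ok) hf h
      exact ⟨c, rfl, .ok h'⟩
  | par P Q hP hQ =>
    cases h with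
    | parL _ h =>
      obtain ⟨c, rfl, h'⟩ := hP hf h
      exact ⟨_, (GClass.rename_mul f c (cls g Q)).symm, h'.parL Q⟩
    | parR _ h =>
      obtain ⟨c, rfl, h'⟩ := hQ hf h
      exact ⟨_, (GClass.rename_mul f (cls g P) c).symm, h'.parR P⟩
  | repl P hP =>
    cases h with
    | repl h =>
      obtain ⟨c, rfl, h'⟩ := hP hf h
      exact ⟨_, (GClass.rename_mul f c (cls g (.repl P))).symm, h'.repl⟩
  | res P hP =>
    rw [Proc.rename_res] at h
    cases h with
    | res h =>
      rw [hK.ren_add_one] at h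
      obtain ⟨c, rfl, h'⟩ := hP (liftRenaming_injective 1 hf) h
      exact ⟨_, (GClass.rename_res _ _).symm, h'.res⟩
  | case p P _ =>
    rw [Proc.rename_case] at h
    cases h with
    | case h =>
      rw [← Proc.rename_case] at h
      obtain ⟨c, rfl, h'⟩ := hK.of_rename hf h
      exact ⟨c, rfl, .case h'⟩

theorem expose_res_res_rename_swap (hK : IsObservation ren K) {e : E} {P : Proc} {c : GClass g}
    (h : Expose ren K e (.res (.res P)) c) :
    Expose ren K e (.res (.res (P.rename (Equiv.swap 0 1)))) c := by
  have hswap : (⇑(Equiv.swap (0 : ℕ) 1) ∘ (· + 1)) ∘ (· + 1) = (· + 1) ∘ (· + 1) :=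
    funext swap_zero_one_add_two
  rcases h with _ | _ | _ | _ | _ | @⟨_, _, _, _ | _ | _ | _ | _ | h⟩
  have h := hK.expose_rename (Equiv.swap 0 1).injective h
  rw [hK.ren_ren, hK.ren_ren, hswap, ← hK.ren_ren] at h
  simpa only [GClass.res_res_rename_swap] using h.res.res

theorem expose_of_law (hK : IsObservation ren K) {P Q : Proc} (hPQ : Law g P Q) {e : E}
    {c : GClass g} (h : Expose ren K e P c) : Expose ren K e Q c := by
  cases hPQ with
  | par_nil =>
    cases h with
    | parL _ h => simpa only [cls_nil, mul_one] using h
    | parR _ h => cases h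
  | par_comm =>
    cases h with
    | parL _ h => simpa only [mul_comm] using h.parR _
    | parR _ h => simpa only [mul_comm] using h.parL _
  | par_assoc =>
    cases h with
    | parL _ h => simpa only [cls_par, mul_assoc] using (h.parL _).parL _
    | parR _ h =>
      cases h with
      | parL _ h => simpa only [mul_assoc] using (h.parR _).parL _
      | parR _ h => simpa only [cls_par, mul_assoc] using h.parR (.par _ _)
  | res_nil => cases h with | res h => cases h
  | res_res => exact hK.expose_res_res_rename_swap h
  | repl_unfold => cases h with | repl h => exact h.parL _
  | par_res P Q =>
    cases h with
    | parL _ h =>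
      have := ((hK.expose_rename (add_left_injective 1) h).parL Q).res
      simpa only [cls_res, GClass.res_rename_mul] using this
    | parR _ h =>
      cases h with
      | res h =>
        simpa only [cls_rename, GClass.res_rename_mul] using (h.parR (P.rename (· + 1))).res
  | dead =>
    cases h with
    | res h => cases h with | case h => exact (hK.not_dead h).elim

theorem expose_of_law_symm (hK : IsObservation ren K) {P Q : Proc} (hPQ : Law g P Q) {e : E}
    {c : GClass g} (h : Expose ren K e Q c) : Expose ren K e P c := by
  cases hPQ with
  | par_nil => simpa only [cls_nil, mul_one] using h.parL .nil
  | par_comm => exact hK.expose_of_law (.par_comm _ _) h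
  | par_assoc =>
    cases h with
    | parL _ h =>
      cases h with
      | parL _ h => simpa only [cls_par, mul_assoc] using h.parL (.par _ _)
      | parR _ h => simpa only [mul_assoc] using (h.parL _).parR _
    | parR _ h => simpa only [cls_par, mul_assoc] using (h.parR _).parR _
  | res_nil => cases h
  | res_res =>
    simpa only [Proc.rename_swap_rename_swap] using hK.expose_res_res_rename_swap h
  | repl_unfold =>
    cases h with
    | parL _ h => exact h.repl
    | parR _ h =>
      cases h with
      | repl h =>
        simpa only [cls_repl, mul_left_comm, ← GClass.repl_eq_mul_repl] using h.repl
  | par_res P Q =>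
    cases h with
    | res h =>
      cases h with
      | parL _ h =>
        obtain ⟨c, rfl, h'⟩ := hK.expose_of_rename (add_left_injective 1) h
        simpa only [cls_res, GClass.res_rename_mul] using h'.parL (.res Q)
      | parR _ h => simpa only [cls_rename, GClass.res_rename_mul] using h.res.parR P
  | dead => cases h

theorem expose_gcong (hK : IsObservation ren K) {P Q : Proc} (hPQ : GCong g P Q) {e : E}
    {c : GClass g} (h : Expose ren K e P c) : Expose ren K e Q c := by
  induction hPQ generalizing e c with
  | law hPQ => exact hK.expose_of_law hPQ h
  | law_symm hPQ => exact hK.expose_of_law_symm hPQ h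
  | refl => exact h
  | trans _ _ ih₁ ih₂ => exact ih₂ (ih₁ h)
  | par hP hQ ihP ihQ =>
    cases h with
    | parL _ h => exact hQ.cls_eq ▸ (ihP h).parL _
    | parR _ h => exact hP.cls_eq ▸ (ihQ h).parR _
  | repl hP ih =>
    cases h with
    | repl h => exact hP.repl.cls_eq ▸ (ih h).repl
  | res _ ih =>
    cases h with
    | res h => exact (ih h).res
  | case _ hP =>
    cases h with
    | case h => exact .case (hK.gcong hP h)

end IsObservation

end CPC

namespace CPC

variable {g : Prop}

/-- The reaction of two cases, the first being the environment of the second; the last argument is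
what they become. -/
inductive React : Proc → Proc → GClass g → Prop
  | unify {p q : Pat} {σ ρ : List Comm} {A B : Proc} : Unify p q σ ρ →
      React (.case q B) (.case p A) (cls g (A.subst (inst σ)) * cls g (B.subst (inst ρ)))

theorem React.symm {U T : Proc} {c : GClass g} (h : React U T c) : React T U c := by
  obtain ⟨hu⟩ := h
  rw [mul_comm]
  exact .unify hu.symm

theorem React.isObservation (g : Prop) : IsObservation Proc.rename (React (g := g)) where
  ren_ren f h P := Proc.rename_rename f h P
  gcong := by
    rintro e p A B c hAB ⟨hu⟩
    rw [(hAB.subst _).cls_eq]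
    exact .unify hu
  rename := by
    rintro f e T c _ ⟨hu⟩
    rw [GClass.rename_mul, ← cls_rename, ← cls_rename, Proc.rename_subst_inst,
      Proc.rename_subst_inst, hu.length_left, hu.length_right, Proc.rename_case, Proc.rename_case]
    exact .unify (hu.rename f)
  of_rename := by
    intro f e T c' hf h
    generalize hU : e.rename f = U at h
    generalize hV : T.rename f = V at h
    obtain ⟨hu⟩ := h
    obtain ⟨q, B, rfl, rfl, rfl⟩ := Proc.rename_eq_case.1 hU
    obtain ⟨p, A, rfl, rfl, rfl⟩ := Proc.rename_eq_case.1 hV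
    obtain ⟨σ, ρ, hu', rfl, rfl⟩ := hu.of_rename hf
    refine ⟨_, ?_, .unify hu'⟩
    rw [GClass.rename_mul, ← cls_rename, ← cls_rename, Proc.rename_subst_inst,
      Proc.rename_subst_inst, hu'.length_left, hu'.length_right]
  not_dead := by
    intro e p A c h
    generalize hU : e.rename (· + 1) = U at h
    obtain ⟨hu⟩ := h
    obtain ⟨q, B, rfl, rfl, rfl⟩ := Proc.rename_eq_case.1 hU
    exact hu.symm.not_comp_prot (by simp)

/-- The environment `P` exposes a case that reacts with the case `T`. -/
abbrev ReactWith (P T : Proc) (c : GClass g) : Prop := Expose Proc.rename React T P c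

/-- `P` and `Q` expose cases that react. -/
abbrev Interact (P Q : Proc) (c : GClass g) : Prop := Expose Proc.rename ReactWith P Q c

namespace ReactWith

theorem gcong_case {p : Pat} {A B P : Proc} {c : GClass g} (hAB : GCong g A B)
    (h : ReactWith P (.case p A) c) : ReactWith P (.case p B) c := by
  rw [← mul_one c]
  refine Expose.frame (Φ := fun T T' s => ∃ p A B, GCong g A B ∧
    T = .case p A ∧ T' = .case p B ∧ s = 1) ?_ ?_ ⟨p, A, B, hAB, rfl, rfl, rfl⟩ h
  · rintro _ _ _ ⟨p, A, B, hAB, rfl, rfl, rfl⟩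
    exact ⟨_, _, _, hAB.rename _, Proc.rename_case _ _ _, Proc.rename_case _ _ _,
      GClass.rename_one _⟩
  · rintro _ _ _ _ _ ⟨p, A, B, hAB, rfl, rfl, rfl⟩ h
    rw [mul_one]
    exact ((React.isObservation g).gcong hAB h.symm).symm

theorem not_dead {f : ℕ → ℕ} {i : ℕ} (hi : i ∉ Set.range f) {p : Pat} {A P : Proc}
    {c : GClass g} : ¬ ReactWith (P.rename f) (.case (.comp (.prot i) p) A) c := by
  intro h
  induction P generalizing f i p A c with
  | nil => cases h
  | ok => cases h with | ok h => cases h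
  | par P Q hP hQ =>
    cases h with
    | parL _ h => exact hP hi h
    | parR _ h => exact hQ hi h
  | repl P hP => cases h with | repl h => exact hP hi h
  | res P hP =>
    rw [Proc.rename_res] at h
    cases h with
    | res h =>
      rw [Proc.rename_case] at h
      exact hP (add_notMem_range_liftRenaming 1 hi) h
  | case q P _ =>
    rw [Proc.rename_case] at h
    cases h with
    | case h => cases h with | unify hu => exact hu.not_comp_prot hi

theorem isObservation (g : Prop) : IsObservation Proc.rename (ReactWith (g := g)) where
  ren_ren f h P := Proc.rename_rename f h P
  gcong := gcong_case
  rename hf h := (React.isObservation g).expose_rename hf h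
  of_rename hf h := (React.isObservation g).expose_of_rename hf h
  not_dead := not_dead (by simp)

theorem interact {T P : Proc} {c : GClass g} (h : ReactWith P T c) : Interact T P c := by
  rw [← mul_one c]
  refine Expose.frame (Φ := fun T T' s => T = T' ∧ s = 1) ?_ ?_ ⟨rfl, rfl⟩ h
  · rintro _ _ _ ⟨rfl, rfl⟩
    exact ⟨rfl, rfl⟩
  · rintro _ _ _ _ _ ⟨rfl, rfl⟩ h
    rw [mul_one]
    obtain ⟨hu⟩ := h
    exact .case (React.unify hu).symm

end ReactWith

namespace Interact

theorem par_left {P Q : Proc} {c : GClass g} (S : Proc) (h : Interact P Q c) :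
    Interact (.par P S) Q (c * cls g S) :=
  Expose.frame (Φ := fun P P' s => ∃ S, P' = .par P S ∧ s = cls g S)
    (by rintro P _ _ ⟨S, rfl, rfl⟩; exact ⟨S.rename _, rfl, rfl⟩)
    (by rintro _ _ _ _ _ ⟨S, rfl, rfl⟩ h; exact h.parL S) ⟨S, rfl, rfl⟩ h

theorem par_right {P Q : Proc} {c : GClass g} (S : Proc) (h : Interact P Q c) :
    Interact (.par S P) Q (c * cls g S) :=
  Expose.frame (Φ := fun P P' s => ∃ S, P' = .par S P ∧ s = cls g S)
    (by rintro P _ _ ⟨S, rfl, rfl⟩; exact ⟨S.rename _, rfl, rfl⟩)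
    (by rintro _ _ _ _ c ⟨S, rfl, rfl⟩ h; exact mul_comm c _ ▸ h.parR S) ⟨S, rfl, rfl⟩ h

theorem repl_left {P Q : Proc} {c : GClass g} (h : Interact P Q c) :
    Interact (.repl P) Q (c * cls g (.repl P)) :=
  Expose.frame (Φ := fun P P' s => P' = .repl P ∧ s = cls g (.repl P))
    (by rintro P _ _ ⟨rfl, rfl⟩; exact ⟨rfl, rfl⟩)
    (by rintro _ _ _ _ _ ⟨rfl, rfl⟩ h; exact h.repl) ⟨rfl, rfl⟩ h

theorem res_left {P Q : Proc} {c : GClass g} (h : Interact P (Q.rename (· + 1)) c) :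
    Interact (.res P) Q c.res := by
  induction Q generalizing P c with
  | nil => cases h
  | ok => cases h with | ok h => exact .ok h.res
  | par Q S hQ hS =>
    cases h with
    | parL _ h =>
      exact GClass.res_mul_rename _ (cls g S) ▸ (hQ h).parL S
    | parR _ h =>
      exact GClass.res_rename_mul (cls g Q) _ ▸ (hS h).parR Q
  | repl Q hQ =>
    cases h with
    | repl h =>
      exact GClass.res_mul_rename _ (cls g (.repl Q)) ▸ (hQ h).repl
  | res Q hQ =>
    rw [Proc.rename_res] at h
    cases h with
    | res h =>
      have h := (ReactWith.isObservation g).expose_rename (Equiv.swap 0 1).injective h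
      rw [Proc.rename_rename, Proc.rename_rename, swap_zero_one_comp_add_one,
        swap_zero_one_comp_liftRenaming] at h
      have h := hQ h
      rw [← Proc.rename_res] at h
      simpa only [GClass.res_res_rename_swap] using h.res
  | case p A _ =>
    rw [Proc.rename_case] at h
    cases h with
    | case h =>
      rw [← Proc.rename_case] at h
      exact .case h.res

theorem symm {P Q : Proc} {c : GClass g} (h : Interact P Q c) : Interact Q P c := by
  induction h with
  | ok h => exact ReactWith.interact h
  | case h => exact ReactWith.interact h
  | parL Q _ ih => exact ih.par_left Q
  | parR P _ ih => exact mul_comm (cls g P) _ ▸ ih.par_right P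
  | repl _ ih => exact ih.repl_left
  | res _ ih => exact ih.res_left

theorem gcong {P P' Q Q' : Proc} {c : GClass g} (hP : GCong g P P') (hQ : GCong g Q Q')
    (h : Interact P Q c) : Interact P' Q' c := by
  have hobs := ReactWith.isObservation g
  exact symm (hobs.expose_gcong hP (symm (hobs.expose_gcong hQ h)))

end Interact

/-! ### Reduction as a relation on classes -/

/-- Reduction of a process to a class, defined by induction on the process without using structural
congruence. -/
inductive Step : Proc → GClass g → Prop
  | interact {P Q : Proc} {c : GClass g} : Interact P Q c → Step (.par P Q) c
  | parL {P : Proc} {c : GClass g} (Q : Proc) : Step P c → Step (.par P Q) (c * cls g Q)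
  | parR (P : Proc) {Q : Proc} {c : GClass g} : Step Q c → Step (.par P Q) (cls g P * c)
  | repl {P : Proc} {c : GClass g} : Step P c → Step (.repl P) (c * cls g (.repl P))
  | repl_interact {P : Proc} {c : GClass g} :
      Interact P P c → Step (.repl P) (c * cls g (.repl P))
  | res {P : Proc} {c : GClass g} : Step P c → Step (.res P) c.res

namespace Step

theorem rename {f : ℕ → ℕ} (hf : Function.Injective f) {P : Proc} {c : GClass g}
    (h : Step P c) : Step (P.rename f) (c.rename f) := by
  have hobs := ReactWith.isObservation g
  induction h generalizing f with
  | interact h => exact .interact (hobs.expose_rename hf h)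
  | parL Q _ ih => rw [GClass.rename_mul]; exact (ih hf).parL (Q.rename f)
  | parR P _ ih => rw [GClass.rename_mul]; exact (ih hf).parR (P.rename f)
  | repl _ ih => rw [GClass.rename_mul]; exact (ih hf).repl
  | repl_interact h => rw [GClass.rename_mul]; exact .repl_interact (hobs.expose_rename hf h)
  | res _ ih =>
    rw [GClass.rename_res, Proc.rename_res]
    exact (ih (liftRenaming_injective 1 hf)).res

theorem of_rename {f : ℕ → ℕ} (hf : Function.Injective f) {P : Proc} {c' : GClass g}
    (h : Step (P.rename f) c') : ∃ c, c' = c.rename f ∧ Step P c := by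
  have hobs := ReactWith.isObservation g
  induction P generalizing f c' with
  | nil => cases h
  | ok => cases h
  | par P Q hP hQ =>
    cases h with
    | interact h =>
      obtain ⟨c, rfl, h'⟩ := hobs.expose_of_rename hf h
      exact ⟨c, rfl, .interact h'⟩
    | parL _ h =>
      obtain ⟨c, rfl, h'⟩ := hP hf h
      exact ⟨_, (GClass.rename_mul f c (cls g Q)).symm, h'.parL Q⟩
    | parR _ h =>
      obtain ⟨c, rfl, h'⟩ := hQ hf h
      exact ⟨_, (GClass.rename_mul f (cls g P) c).symm, h'.parR P⟩
  | repl P hP =>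
    cases h with
    | repl h =>
      obtain ⟨c, rfl, h'⟩ := hP hf h
      exact ⟨_, (GClass.rename_mul f c (cls g (.repl P))).symm, h'.repl⟩
    | repl_interact h =>
      obtain ⟨c, rfl, h'⟩ := hobs.expose_of_rename hf h
      exact ⟨_, (GClass.rename_mul f c (cls g (.repl P))).symm, .repl_interact h'⟩
  | res P hP =>
    rw [Proc.rename_res] at h
    cases h with
    | res h =>
      obtain ⟨c, rfl, h'⟩ := hP (liftRenaming_injective 1 hf) h
      exact ⟨_, (GClass.rename_res _ _).symm, h'.res⟩
  | case p P _ => cases h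

theorem res_res_rename_swap {P : Proc} {c : GClass g} (h : Step (.res (.res P)) c) :
    Step (.res (.res (P.rename (Equiv.swap 0 1)))) c := by
  rcases h with _ | _ | _ | _ | _ | ⟨_ | _ | _ | _ | _ | h⟩
  simpa only [GClass.res_res_rename_swap] using (h.rename (Equiv.swap 0 1).injective).res.res

theorem par_comm {P Q : Proc} {c : GClass g} (h : Step (.par P Q) c) : Step (.par Q P) c := by
  cases h with
  | interact h => exact .interact h.symm
  | parL _ h => exact mul_comm (cls g Q) _ ▸ h.parR Q
  | parR _ h => exact mul_comm _ (cls g P) ▸ h.parL P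

theorem par_assoc {P Q R : Proc} {c : GClass g} (h : Step (.par P (.par Q R)) c) :
    Step (.par (.par P Q) R) c := by
  cases h with
  | interact h =>
    cases h with
    | parL _ h => exact (Step.interact h).parL R
    | parR _ h => simpa only [mul_comm] using Step.interact (Interact.par_left Q h)
  | parL _ h => simpa only [cls_par, mul_assoc] using (h.parL Q).parL R
  | parR _ h =>
    cases h with
    | interact h => simpa only [mul_comm] using Step.interact (Interact.par_right P h)
    | parL _ h => simpa only [mul_assoc] using (h.parR P).parL R
    | parR _ h => simpa only [cls_par, mul_assoc] using h.parR (.par P Q)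

theorem of_par_repl {P : Proc} {c : GClass g} (h : Step (.par P (.repl P)) c) :
    Step (.repl P) c := by
  cases h with
  | interact h => cases h with | repl h => exact .repl_interact h
  | parL _ h => exact h.repl
  | parR _ h =>
    cases h with
    | repl h => simpa only [cls_repl, mul_left_comm, ← GClass.repl_eq_mul_repl] using h.repl
    | repl_interact h =>
      simpa only [cls_repl, mul_left_comm, ← GClass.repl_eq_mul_repl] using Step.repl_interact h

theorem of_law {P Q : Proc} (hPQ : Law g P Q) {c : GClass g} (h : Step P c) : Step Q c := by
  cases hPQ with
  | par_nil =>
    cases h with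
    | interact h => cases h
    | parL _ h => simpa only [cls_nil, mul_one] using h
    | parR _ h => cases h
  | par_comm => exact h.par_comm
  | par_assoc => exact h.par_assoc
  | res_nil => cases h with | res h => cases h
  | res_res => exact h.res_res_rename_swap
  | repl_unfold =>
    cases h with
    | repl h => exact h.parL _
    | repl_interact h => exact .interact h.repl
  | par_res P Q =>
    cases h with
    | interact h => cases h with | res h => exact (Step.interact h).res
    | parL _ h =>
      have := ((h.rename (add_left_injective 1)).parL Q).res
      simpa only [cls_res, GClass.res_rename_mul] using this
    | parR _ h =>
      cases h with
      | res h =>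
        simpa only [cls_rename, GClass.res_rename_mul] using (h.parR (P.rename (· + 1))).res
  | dead => cases h with | res h => cases h

theorem of_law_symm {P Q : Proc} (hPQ : Law g P Q) {c : GClass g} (h : Step Q c) : Step P c := by
  cases hPQ with
  | par_nil => simpa only [cls_nil, mul_one] using h.parL .nil
  | par_comm => exact h.par_comm
  | par_assoc => exact h.par_comm.par_assoc.par_comm.par_assoc.par_comm
  | res_nil => cases h
  | res_res => simpa only [Proc.rename_swap_rename_swap] using h.res_res_rename_swap
  | repl_unfold => exact h.of_par_repl
  | par_res P Q =>
    cases h with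
    | res h =>
      cases h with
      | interact h => exact .interact h.res
      | parL _ h =>
        obtain ⟨c, rfl, h'⟩ := h.of_rename (add_left_injective 1)
        simpa only [cls_res, GClass.res_rename_mul] using h'.parL (.res Q)
      | parR _ h => simpa only [cls_rename, GClass.res_rename_mul] using h.res.parR P
  | dead => cases h

theorem gcong {P Q : Proc} (hPQ : GCong g P Q) {c : GClass g} (h : Step P c) : Step Q c := by
  induction hPQ generalizing c with
  | law hPQ => exact h.of_law hPQ
  | law_symm hPQ => exact h.of_law_symm hPQ
  | refl => exact h
  | trans _ _ ih₁ ih₂ => exact ih₂ (ih₁ h)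
  | par hP hQ ihP ihQ =>
    cases h with
    | interact h => exact .interact (h.gcong hP hQ)
    | parL _ h => exact hQ.cls_eq ▸ (ihP h).parL _
    | parR _ h => exact hP.cls_eq ▸ (ihQ h).parR _
  | repl hP ih =>
    cases h with
    | repl h => exact hP.repl.cls_eq ▸ (ih h).repl
    | repl_interact h => exact hP.repl.cls_eq ▸ .repl_interact (h.gcong hP hP)
  | res _ ih => cases h with | res h => exact (ih h).res
  | case => cases h

end Step

theorem Red.step (g : Prop) {P R : Proc} (h : Red P R) : Step P (cls g R) := by
  induction h with
  | unify P Q hu => exact .interact (.case (.case (.unify hu)))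
  | par Q _ ih => exact ih.parL Q
  | res _ ih => exact ih.res
  | struct hPQ _ hQR ih => exact (hQR.gcong g).cls_eq ▸ ih.gcong (hPQ.gcong g).symm

theorem Red.of_cls_eq {P Q R : Proc} (hPQ : cls False P = cls False Q) (h : Red Q R) : Red P R :=
  .struct (cls_eq_cls.1 hPQ).cong h (.refl R)

theorem React.exists_red {U T : Proc} {c : GClass g} (h : React U T c) :
    ∃ R, Red (.par U T) R ∧ cls g R = c := by
  obtain ⟨hu⟩ := h
  exact ⟨_, .unify _ _ hu.symm, mul_comm (cls g _) (cls g _)⟩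

theorem Expose.exists_red {K : Proc → Proc → GClass g → Prop}
    (hK : ∀ {e T c}, K e T c → ∃ R, Red (.par e T) R ∧ cls g R = c) {e P : Proc} {c : GClass g}
    (h : Expose Proc.rename K e P c) : ∃ R, Red (.par e P) R ∧ cls g R = c := by
  induction h with
  | ok h => exact hK h
  | case h => exact hK h
  | parL Q _ ih =>
    obtain ⟨R, h, rfl⟩ := ih
    exact ⟨_, .of_cls_eq (by simp only [cls_par, mul_assoc]) (h.par Q), rfl⟩
  | parR P _ ih =>
    obtain ⟨R, h, rfl⟩ := ih
    exact ⟨_, .of_cls_eq (by simp only [cls_par]; ac_rfl) (h.par P), mul_comm (cls g R) (cls g P)⟩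
  | @repl _ P _ _ ih =>
    obtain ⟨R, h, rfl⟩ := ih
    refine ⟨_, .of_cls_eq ?_ (h.par (.repl P)), rfl⟩
    rw [cls_par, cls_repl, GClass.repl_eq_mul_repl]
    simp only [cls_par, cls_repl, mul_assoc]
  | @res e P _ _ ih =>
    obtain ⟨R, h, rfl⟩ := ih
    exact ⟨_, .of_cls_eq (GClass.res_rename_mul (cls _ e) (cls _ P)).symm h.res, rfl⟩

theorem Interact.exists_red {P Q : Proc} {c : GClass g} (h : Interact P Q c) :
    ∃ R, Red (.par P Q) R ∧ cls g R = c :=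
  Expose.exists_red (fun hT => by
    obtain ⟨R, h', rfl⟩ := Expose.exists_red React.exists_red hT
    exact ⟨R, .of_cls_eq (mul_comm (cls _ _) (cls _ _)) h', rfl⟩) h

theorem Step.exists_red {P : Proc} {c : GClass g} (h : Step P c) :
    ∃ R, Red P R ∧ cls g R = c := by
  induction h with
  | interact h => exact h.exists_red
  | parL Q _ ih =>
    obtain ⟨R, h, rfl⟩ := ih
    exact ⟨_, h.par Q, rfl⟩
  | parR P _ ih =>
    obtain ⟨R, h, rfl⟩ := ih
    exact ⟨_, .of_cls_eq (mul_comm (cls _ P) (cls _ _)) (h.par P), mul_comm (cls g R) (cls g P)⟩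
  | @repl P _ _ ih =>
    obtain ⟨R, h, rfl⟩ := ih
    exact ⟨_, .of_cls_eq (GClass.repl_eq_mul_repl (cls _ P)) (h.par (.repl P)), rfl⟩
  | @repl_interact P _ h =>
    obtain ⟨R, h', rfl⟩ := h.exists_red
    refine ⟨_, .of_cls_eq ?_ (h'.par (.repl P)), rfl⟩
    rw [cls_par, cls_par, cls_repl, mul_assoc, ← GClass.repl_eq_mul_repl,
      ← GClass.repl_eq_mul_repl]
  | res _ ih =>
    obtain ⟨R, h, rfl⟩ := ih
    exact ⟨_, h.res, rfl⟩

theorem GCong.red {P Q P' : Proc} (h : GCong g P Q) (h' : Red P P') :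
    ∃ Q', Red Q Q' ∧ GCong g P' Q' := by
  obtain ⟨Q', hQ, hcls⟩ := ((h'.step g).gcong h).exists_red
  exact ⟨Q', hQ, cls_eq_cls.1 hcls.symm⟩

end CPC

namespace CPC

variable {g : Prop}

/-! ### Barbs and success -/

/-- The base relation for barbs.  The environment consists of the set of public names and of the
barb, which is the set of the public names that occur in the pattern. -/
inductive ShowsBarb : Set ℕ × Set ℕ → Proc → GClass g → Prop
  | case {e : Set ℕ × Set ℕ} {p : Pat} (A : Proc) :
      p.pn ⊆ e.1 → p.fn ∩ e.1 = e.2 → ShowsBarb e (.case p A) 1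

theorem ShowsBarb.isObservation (g : Prop) :
    IsObservation (fun f => Prod.map (Set.image f) (Set.image f)) (ShowsBarb (g := g)) where
  ren_ren f h e := by simp only [Prod.map_apply', Set.image_image, Function.comp_def]
  gcong := by
    rintro e p A B c _ ⟨_, hpn, hfn⟩
    exact .case B hpn hfn
  rename := by
    rintro f e T c hf ⟨A, hpn, hfn⟩
    rw [Proc.rename_case]
    refine .case _ ?_ ?_
    · rw [Pat.pn_rename]
      exact Set.image_mono hpn
    · rw [Pat.fn_rename, Prod.map_fst, ← Set.image_inter hf, hfn, Prod.map_snd]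
  of_rename := by
    intro f e T c hf h
    generalize hT : T.rename f = T' at h
    obtain ⟨A', hpn, hfn⟩ := h
    obtain ⟨p, A, rfl, rfl, rfl⟩ := Proc.rename_eq_case.1 hT
    rw [Pat.pn_rename] at hpn
    rw [Pat.fn_rename, Prod.map_fst, ← Set.image_inter hf, Prod.map_snd] at hfn
    exact ⟨1, rfl, .case A ((Set.image_subset_image_iff hf).1 hpn) (hf.image_injective hfn)⟩
  not_dead := by
    rintro e p A c ⟨_, hpn, _⟩
    obtain ⟨j, _, hj⟩ := hpn (Or.inl rfl : 0 ∈ _)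
    exact Nat.succ_ne_zero j hj

/-- The process `P` exposes a case with the barb `e.2`, where `e.1` are the public names. -/
abbrev ExposesBarb (e : Set ℕ × Set ℕ) (P : Proc) (c : GClass g) : Prop :=
  Expose (fun f => Prod.map (Set.image f) (Set.image f)) ShowsBarb e P c

theorem GClass.iterate_res_mul_rename (k : ℕ) (c d : GClass g) :
    GClass.res^[k] (c * d.rename (· + k)) = GClass.res^[k] c * d := by
  obtain ⟨P, rfl⟩ := exists_cls_eq d
  induction k generalizing c P with
  | zero => exact congrArg (c * cls g ·) (Proc.rename_id P)
  | succ k ih =>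
    have hP : P.rename (· + (k + 1)) = (P.rename (· + k)).rename (· + 1) := by
      rw [Proc.rename_rename]
      rfl
    rw [← cls_rename, hP, cls_rename, Function.iterate_succ_apply, GClass.res_mul_rename,
      Function.iterate_succ_apply]
    exact ih c.res P

theorem cls_iterate_res (k : ℕ) (P : Proc) :
    cls g (Proc.res^[k] P) = GClass.res^[k] (cls g P) :=
  Function.Semiconj.iterate_right (f := cls g) (fun _ => rfl) k P

namespace ExposesBarb

theorem exists_cls_eq_iterate_res {e : Set ℕ × Set ℕ} {P : Proc} {c : GClass g}
    (h : ExposesBarb e P c) (g' : Prop) :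
    ∃ k p A d, cls g' P = GClass.res^[k] (cls g' (.case p A) * d) ∧
      p.pn ⊆ (· + k) '' e.1 ∧ p.fn ∩ (· + k) '' e.1 = (· + k) '' e.2 := by
  induction h with
  | ok h => cases h
  | @case _ p A _ h =>
    obtain ⟨_, hpn, hfn⟩ := h
    exact ⟨0, p, A, 1, by simp, by simpa, by simpa⟩
  | parL Q _ ih =>
    obtain ⟨k, p, A, d, hP, h⟩ := ih
    refine ⟨k, p, A, d * (cls g' Q).rename (· + k), ?_, h⟩
    rw [cls_par, hP, ← mul_assoc, GClass.iterate_res_mul_rename]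
  | parR Q _ ih =>
    obtain ⟨k, p, A, d, hP, h⟩ := ih
    refine ⟨k, p, A, d * (cls g' Q).rename (· + k), ?_, h⟩
    rw [cls_par, hP, ← mul_assoc, GClass.iterate_res_mul_rename, mul_comm]
  | @repl _ P _ _ ih =>
    obtain ⟨k, p, A, d, hP, h⟩ := ih
    refine ⟨k, p, A, d * (cls g' (.repl P)).rename (· + k), ?_, h⟩
    rw [← mul_assoc, GClass.iterate_res_mul_rename, ← hP, cls_repl, ← GClass.repl_eq_mul_repl]
  | res _ ih =>
    obtain ⟨k, p, A, d, hP, hpn, hfn⟩ := ih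
    refine ⟨k + 1, p, A, d, ?_, ?_, ?_⟩
    · rw [cls_res, hP, Function.iterate_succ_apply']
    · simpa [Set.image_image, add_assoc, add_comm 1 k] using hpn
    · simpa [Set.image_image, add_assoc, add_comm 1 k] using hfn

theorem iterate_res {k : ℕ} {e : Set ℕ × Set ℕ} {p : Pat} (A B : Proc)
    (hpn : p.pn ⊆ (· + k) '' e.1) (hfn : p.fn ∩ (· + k) '' e.1 = (· + k) '' e.2) :
    ∃ c : GClass g, ExposesBarb e (Proc.res^[k] (.par (.case p A) B)) c := by
  induction k generalizing e with
  | zero => exact ⟨_, .parL B (.case (.case A (by simpa using hpn) (by simpa using hfn)))⟩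
  | succ k ih =>
    rw [Function.iterate_succ_apply']
    obtain ⟨c, h⟩ := ih (e := Prod.map (Set.image (· + 1)) (Set.image (· + 1)) e)
      (by simpa [Set.image_image, add_assoc, add_comm 1 k] using hpn)
      (by simpa [Set.image_image, add_assoc, add_comm 1 k] using hfn)
    exact ⟨_, h.res⟩

end ExposesBarb

theorem image_add_univ (k : ℕ) : (· + k) '' (Set.univ : Set ℕ) = Set.Ici k := by
  ext i
  simp [le_iff_exists_add', eq_comm]

theorem inter_Ici_eq_image_add_iff {s m : Set ℕ} {k : ℕ} :
    s ∩ Set.Ici k = (· + k) '' m ↔ m = {i | i + k ∈ s} := by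
  constructor
  · intro h
    ext i
    simpa using (Set.ext_iff.1 h (i + k)).symm
  · rintro rfl
    ext i
    constructor
    · rintro ⟨hs, hi⟩
      exact ⟨i - k, by simpa [Nat.sub_add_cancel hi] using hs, Nat.sub_add_cancel hi⟩
    · rintro ⟨j, hj, rfl⟩
      exact ⟨hj, Nat.le_add_left _ _⟩

theorem barb_iff {P : Proc} {m : Set ℕ} (g : Prop) :
    Barb P m ↔ ∃ c : GClass g, ExposesBarb (Set.univ, m) P c := by
  constructor
  · rintro ⟨k, p, A, B, hP, hpn, hm⟩
    obtain ⟨c, h⟩ := ExposesBarb.iterate_res (g := g) (e := (Set.univ, m)) (k := k) A B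
      (by rw [image_add_univ]; exact hpn)
      (by rw [image_add_univ]; exact inter_Ici_eq_image_add_iff.2 hm)
    exact ⟨c, (ShowsBarb.isObservation g).expose_gcong (hP.gcong g).symm h⟩
  · rintro ⟨c, h⟩
    obtain ⟨k, p, A, d, hP, hpn, hfn⟩ := h.exists_cls_eq_iterate_res False
    obtain ⟨B, rfl⟩ := exists_cls_eq d
    rw [image_add_univ] at hpn hfn
    rw [← cls_par, ← cls_iterate_res] at hP
    exact ⟨k, p, A, B, (cls_eq_cls.1 hP).cong, hpn, inter_Ici_eq_image_add_iff.1 hfn⟩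

theorem GCong.barb {P Q : Proc} {m : Set ℕ} (hPQ : GCong g P Q) (h : Barb P m) : Barb Q m := by
  obtain ⟨c, h⟩ := (barb_iff g).1 h
  exact (barb_iff g).2 ⟨c, (ShowsBarb.isObservation g).expose_gcong hPQ h⟩

/-- The base relation for success. -/
inductive ShowsOk : Unit → Proc → GClass g → Prop
  | ok : ShowsOk () .ok 1

theorem ShowsOk.isObservation (g : Prop) : IsObservation (fun _ => id) (ShowsOk (g := g)) where
  ren_ren _ _ _ := rfl
  gcong := by rintro _ _ _ _ _ _ ⟨⟩
  rename := by
    rintro _ _ _ _ _ ⟨⟩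
    exact .ok
  of_rename := by
    intro f e T c _ h
    cases T <;> cases h
    exact ⟨1, rfl, .ok⟩
  not_dead := by rintro _ _ _ _ ⟨⟩

/-- The process `P` has an unguarded success process. -/
abbrev ExposesOk (P : Proc) (c : GClass g) : Prop := Expose (fun _ => id) ShowsOk () P c

theorem ExposesOk.exists_cls_eq_mul {P : Proc} {c : GClass g} (h : ExposesOk P c) (g' : Prop) :
    ∃ d, cls g' P = d * cls g' .ok := by
  unfold ExposesOk at h
  generalize () = e at h
  induction h with
  | ok _ => exact ⟨1, (one_mul _).symm⟩
  | case h => cases h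
  | parL Q _ ih =>
    obtain ⟨d, hd⟩ := ih
    exact ⟨d * cls g' Q, by rw [cls_par, hd, mul_right_comm]⟩
  | parR Q _ ih =>
    obtain ⟨d, hd⟩ := ih
    exact ⟨cls g' Q * d, by rw [cls_par, hd, mul_assoc]⟩
  | @repl _ P _ _ ih =>
    obtain ⟨d, hd⟩ := ih
    refine ⟨d * (cls g' P).repl, ?_⟩
    rw [mul_right_comm, ← hd, cls_repl, ← GClass.repl_eq_mul_repl]
  | res _ ih =>
    obtain ⟨d, hd⟩ := ih
    exact ⟨d.res, by rw [cls_res, hd]; exact GClass.res_mul_rename d (cls g' .ok)⟩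

theorem exists_cong_par_ok_iff {P : Proc} (g : Prop) :
    (∃ Q, Cong P (.par Q .ok)) ↔ ∃ c : GClass g, ExposesOk P c := by
  constructor
  · rintro ⟨Q, h⟩
    exact ⟨_, (ShowsOk.isObservation g).expose_gcong (h.gcong g).symm (.parR Q (.ok .ok))⟩
  · rintro ⟨c, h⟩
    obtain ⟨d, hd⟩ := h.exists_cls_eq_mul False
    obtain ⟨Q, rfl⟩ := exists_cls_eq d
    exact ⟨Q, (cls_eq_cls.1 hd).cong⟩

theorem GCong.exists_cong_par_ok {P Q : Proc} (hPQ : GCong g P Q)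
    (h : ∃ P', Cong P (.par P' .ok)) : ∃ Q', Cong Q (.par Q' .ok) := by
  obtain ⟨c, h⟩ := (exists_cong_par_ok_iff g).1 h
  exact (exists_cong_par_ok_iff g).2 ⟨c, (ShowsOk.isObservation g).expose_gcong hPQ h⟩

/-! ### Barbed congruence -/

theorem GCong.plug {P Q : Proc} (h : GCong g P Q) (C : Ctx) :
    GCong g (C.plug fun _ => P) (C.plug fun _ => Q) := by
  induction C with
  | hole _ => exact h
  | nil => exact .refl _
  | ok => exact .refl _
  | par C D hC hD => exact hC.par hD
  | repl C hC => exact hC.repl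
  | res x C hC => exact (hC.rename _).res
  | case p xs _ C hC => exact (hC.rename _).case p

theorem GCong.barbedCong {P Q : Proc} (h : GCong g P Q) : BarbedCong P Q :=
  ⟨GCong g, fun _ _ h => h.symm, fun _ _ _ h h' => h.barb h', fun _ _ _ h h' => h.red h',
    fun _ _ C h _ => h.plug C, h⟩

end CPC

/-! ### The encoding and substitution -/

namespace Spi

theorem Term.subst_name (M : Term) : M.subst .name = M := by
  induction M <;> simp_all only [subst]

theorem liftSubst_id (k : ℕ) : liftSubst k Term.name = Term.name := by
  funext i
  simp only [liftSubst]
  split_ifs with h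
  · rfl
  · simp only [Term.rename, Term.subst, Nat.sub_add_cancel (not_lt.1 h)]

theorem Proc.subst_name (P : Proc) : P.subst .name = P := by
  induction P <;> simp_all only [subst, liftSubst_id, Term.subst_name]

/-- The names chosen for the encoding are distinct. -/
structure Admissible (ι : ℕ → ℕ) (τ : Tag → ℕ) : Prop where
  inj : Function.Injective ι
  tag_inj : Function.Injective τ
  ne : ∀ a t, ι a ≠ τ t

variable {ι ι' : ℕ → ℕ} {τ τ' : Tag → ℕ}

theorem Admissible.shift (h : Admissible ι τ) (k : ℕ) : Admissible (ι · + k) (τ · + k) where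
  inj := (add_left_injective k).comp h.inj
  tag_inj := (add_left_injective k).comp h.tag_inj
  ne a t e := h.ne a t (Nat.add_right_cancel e)

theorem Admissible.lift (h : Admissible ι τ) (k : ℕ) :
    Admissible (liftRenaming k ι) (τ · + k) where
  inj := liftRenaming_injective k h.inj
  tag_inj := (add_left_injective k).comp h.tag_inj
  ne a t e := add_notMem_range_liftRenaming k (fun ⟨b, hb⟩ => h.ne b t hb) ⟨a, e⟩

theorem Term.encode_injective (h : Admissible ι τ) : Function.Injective (Term.encode ι τ) := by
  intro M
  induction M <;> intro N e <;> cases N <;>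
    simp_all [encode, h.inj.eq_iff, h.tag_inj.eq_iff, h.ne, (h.ne _ _).symm] <;> grind

/-- On encodings of names in `s`, the CPC substitution `φ` acts as the Spi substitution `f`. -/
structure Simulates (s : Set ℕ) (ι : ℕ → ℕ) (τ : Tag → ℕ) (ι' : ℕ → ℕ) (τ' : Tag → ℕ)
    (f : ℕ → Term) (φ : ℕ → CPC.Comm) : Prop where
  name : ∀ a ∈ s, φ (ι a) = (f a).encode ι' τ'
  tag : ∀ t, φ (τ t) = .name (τ' t)

variable {s t : Set ℕ} {f : ℕ → Term} {φ : ℕ → CPC.Comm}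

theorem simulates_union :
    Simulates (s ∪ t) ι τ ι' τ' f φ ↔ Simulates s ι τ ι' τ' f φ ∧ Simulates t ι τ ι' τ' f φ :=
  ⟨fun h => ⟨⟨fun a ha => h.name a (.inl ha), h.tag⟩, fun a ha => h.name a (.inr ha), h.tag⟩,
    fun h => ⟨fun a ha => ha.elim (h.1.name a) (h.2.name a), h.1.tag⟩⟩

theorem Term.encode_subst {M : Term} (h : Simulates M.fn ι τ ι' τ' f φ) :
    (M.encode ι τ).subst φ = (M.subst f).encode ι' τ' := by
  induction M with
  | name n => exact h.name n rfl
  | zero => exact h.tag _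
  | suc M hM => simp only [encode, subst, CPC.Comm.subst, h.tag, hM h]
  | pair M N hM hN | encr M N hM hN =>
    obtain ⟨h₁, h₂⟩ := simulates_union.1 h
    simp only [encode, subst, CPC.Comm.subst, h.tag, hM h₁, hN h₂]

theorem Term.encode_rename_add (k : ℕ) (M : Term) :
    (M.encode ι τ).rename (· + k) = M.encode (ι · + k) (τ · + k) := by
  rw [CPC.Comm.rename_eq_subst, encode_subst (f := .name) (ι' := (ι · + k)) (τ' := (τ · + k)),
    subst_name]
  exact ⟨fun _ _ => rfl, fun _ => rfl⟩

theorem Term.encode_rename_add_lift (k : ℕ) (M : Term) :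
    (M.encode ι τ).rename (· + k) = (M.rename (· + k)).encode (liftRenaming k ι) (τ · + k) := by
  rw [CPC.Comm.rename_eq_subst]
  exact encode_subst ⟨fun a _ => by simp only [encode, liftRenaming_add], fun _ => rfl⟩

theorem Simulates.lift {k : ℕ} (h : Simulates {n | n + k ∈ s} ι τ ι' τ' f φ) :
    Simulates s (liftRenaming k ι) (τ · + k) (liftRenaming k ι') (τ' · + k) (liftSubst k f)
      (CPC.liftSubst k φ) where
  name a ha := by
    rcases lt_or_ge a k with hk | hk
    · rw [liftRenaming_lt _ hk, CPC.liftSubst_lt _ hk, liftSubst, if_pos hk, Term.encode,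
        liftRenaming_lt _ hk]
    · obtain ⟨b, rfl⟩ := Nat.exists_eq_add_of_le' hk
      rw [liftRenaming_add, CPC.liftSubst_add, h.name b ha, Term.encode_rename_add_lift, liftSubst,
        if_neg (not_lt.2 hk), Nat.add_sub_cancel]
  tag t := by rw [CPC.liftSubst_add, h.tag]; rfl

theorem Simulates.shift (h : Simulates s ι τ ι' τ' f φ) (k : ℕ) :
    Simulates s (ι · + k) (τ · + k) (ι' · + k) (τ' · + k) f (CPC.liftSubst k φ) where
  name a ha := by rw [CPC.liftSubst_add, h.name a ha, Term.encode_rename_add]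
  tag t := by rw [CPC.liftSubst_add, h.tag]; rfl

section

attribute [local simp] Proc.encode Proc.subst CPC.Proc.subst CPC.Pat.subst CPC.Pat.binders
  CPC.Comm.subst_toPat CPC.liftSubst_zero

theorem Proc.encode_subst {P : Proc} (h : Simulates P.fn ι τ ι' τ' f φ) :
    (P.encode ι τ).subst φ = (P.subst f).encode ι' τ' := by
  have private_name (φ : ℕ → CPC.Comm) : CPC.liftSubst 1 φ 0 = .name 0 := rfl
  induction P generalizing ι τ ι' τ' f φ with
  | nil => rfl
  | ok => rfl
  | par P Q hP hQ =>
    obtain ⟨h₁, h₂⟩ := simulates_union.1 h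
    simp [hP h₁, hQ h₂]
  | repl P hP => simp [hP h]
  | res P hP => simp [hP h.lift]
  | inp M P hP =>
    obtain ⟨h₁, h₂⟩ := simulates_union.1 h
    simp [Term.encode_subst h₁, h.tag, hP h₂.lift, CPC.Comm.toPat]
  | out M N P hP =>
    simp only [fn, simulates_union] at h
    obtain ⟨⟨h₁, h₂⟩, h₃⟩ := h
    simp [Term.encode_subst h₁, Term.encode_subst h₂, hP (h₃.shift 1)]
  | test M N P hP =>
    have h := h.shift 1
    simp only [fn, simulates_union] at h
    obtain ⟨⟨h₁, h₂⟩, h₃⟩ := h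
    simp [private_name, CPC.Comm.protect, Term.encode_subst h₁, Term.encode_subst h₂, hP h₃]
  | split M P hP =>
    have h := h.shift 1
    obtain ⟨h₁, h₂⟩ := simulates_union.1 h
    simp [private_name, CPC.Comm.protect, h.tag, Term.encode_subst h₁, hP h₂.lift]
  | decrypt M N P hP =>
    have h := h.shift 1
    have tag := h.tag
    simp only [fn, simulates_union] at h
    obtain ⟨⟨h₁, h₂⟩, h₃⟩ := h
    simp [private_name, CPC.Comm.protect, tag, Term.encode_subst h₁, Term.encode_subst h₂,
      hP h₃.lift]
  | intCase M P Q hP hQ =>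
    have h := h.shift 1
    have tag := h.tag
    simp only [fn, simulates_union] at h
    obtain ⟨⟨h₁, h₂⟩, h₃⟩ := h
    simp [private_name, CPC.Comm.protect, tag, Term.encode_subst h₁, hP h₂, hQ h₃.lift]

end

theorem Proc.encode_rename {f : ℕ → ℕ} {l : ℕ → ℕ} (P : Proc) (h : ∀ a ∈ P.fn, l (ι a) = ι' (f a))
    (h' : ∀ t, l (τ t) = τ' t) : (P.encode ι τ).rename l = (P.rename f).encode ι' τ' :=
  encode_subst ⟨fun a ha => congrArg CPC.Comm.name (h a ha), fun t => congrArg _ (h' t)⟩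

theorem Proc.encode_rename_add_lift (k : ℕ) (P : Proc) :
    (P.encode ι τ).rename (· + k) = (P.rename (· + k)).encode (liftRenaming k ι) (τ · + k) :=
  encode_rename P (fun a _ => (liftRenaming_add k a ι).symm) fun _ => rfl

theorem Proc.encode_rename_add (k : ℕ) (P : Proc) :
    (P.encode ι τ).rename (· + k) = P.encode (ι · + k) (τ · + k) := by
  rw [encode_rename (f := id) (ι' := (ι · + k)) (τ' := (τ · + k)) P (fun _ _ => rfl) fun _ => rfl]
  exact congrArg _ P.subst_name

theorem Proc.encode_subst_inst (σ : List Term) (P : Proc) :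
    (P.encode (liftRenaming σ.length ι) (τ · + σ.length)).subst
      (CPC.inst (σ.map (Term.encode ι τ))) = (P.subst (inst σ)).encode ι τ := by
  refine encode_subst ⟨fun a _ => ?_, fun t => by simp [CPC.inst]⟩
  simp only [liftRenaming, CPC.inst, inst, List.length_map]
  split_ifs with h
  · simp [h]
  · simp [not_lt.1 h, Term.encode]

theorem Proc.encode_subst_inst_shift (σ : List CPC.Comm) (P : Proc) :
    (P.encode (ι · + σ.length) (τ · + σ.length)).subst (CPC.inst σ) = P.encode ι τ := by
  rw [encode_subst (f := .name) (ι' := ι) (τ' := τ), subst_name]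
  exact ⟨fun a _ => by simp [CPC.inst, Term.encode], fun t => by simp [CPC.inst]⟩

theorem Cong.encode {P Q : Proc} (h : Cong P Q) (ι : ℕ → ℕ) (τ : Tag → ℕ) :
    CPC.Cong (P.encode ι τ) (Q.encode ι τ) := by
  induction h generalizing ι τ with
  | par_nil P => exact .par_nil _
  | par_comm P Q => exact .par_comm _ _
  | par_assoc P Q R => exact .par_assoc _ _ _
  | res_nil => exact .res_nil
  | res_res P =>
    have h := CPC.Cong.res_res (P.encode (liftRenaming 1 (liftRenaming 1 ι)) (τ · + 1 + 1))
    rwa [Proc.encode_rename P (fun a _ => swap_zero_one_liftRenaming_liftRenaming ι a)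
      fun t => swap_zero_one_add_two _] at h
  | repl_unfold P => exact .repl_unfold _
  | par_res P Q =>
    have h := CPC.Cong.par_res (P.encode ι τ) (Q.encode (liftRenaming 1 ι) (τ · + 1))
    rwa [Proc.encode_rename_add_lift] at h
  | refl P => exact .refl _
  | symm _ ih => exact (ih ι τ).symm
  | trans _ _ ih₁ ih₂ => exact (ih₁ ι τ).trans (ih₂ ι τ)
  | par _ _ ih₁ ih₂ => exact (ih₁ ι τ).par (ih₂ ι τ)
  | repl _ ih => exact (ih ι τ).repl
  | res _ ih => exact (ih _ _).res
  | inp M _ ih => exact (ih _ _).case _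
  | out M N _ ih => exact (ih _ _).case _
  | test M N _ ih => exact (((ih _ _).case _).par (.refl _)).res
  | split M _ ih => exact (((ih _ _).case _).par (.refl _)).res
  | decrypt M N _ ih => exact (((ih _ _).case _).par (.refl _)).res
  | intCase M _ _ ih₁ ih₂ =>
    exact (((ih₁ _ _).case _).par (((ih₂ _ _).case _).par (.refl _))).res

end Spi

/-! ### Communication on a private channel -/

namespace CPC

variable {g : Prop}

namespace Unify

theorem comp_iff {p₁ p₂ q₁ q₂ : Pat} {σ ρ : List Comm} :
    Unify (.comp p₁ p₂) (.comp q₁ q₂) σ ρ ↔ ∃ σ₁ ρ₁ σ₂ ρ₂, Unify p₁ q₁ σ₁ ρ₁ ∧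
      Unify p₂ q₂ σ₂ ρ₂ ∧ σ = σ₁ ++ σ₂ ∧ ρ = ρ₁ ++ ρ₂ := by
  constructor
  · rintro (_ | _ | _ | _ | _ | _ | ⟨h₁, h₂⟩)
    exact ⟨_, _, _, _, h₁, h₂, rfl, rfl⟩
  · rintro ⟨_, _, _, _, h₁, h₂, rfl, rfl⟩
    exact h₁.comp h₂

theorem bind_toPat_iff {c : Comm} {σ ρ : List Comm} :
    Unify .bind c.toPat σ ρ ↔ σ = [c] ∧ ρ = [] := by
  constructor
  · generalize hq : c.toPat = q
    intro h
    cases h with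
    | bind_left _ d hd => exact ⟨by rw [Comm.toPat_injective (hq.trans hd)], rfl⟩
    | bind_right => cases c <;> cases hq
  · rintro ⟨rfl, rfl⟩
    exact .bind_left _ c rfl

theorem toPat_bind_iff {c : Comm} {σ ρ : List Comm} :
    Unify c.toPat .bind σ ρ ↔ σ = [] ∧ ρ = [c] :=
  ⟨fun h => (bind_toPat_iff.1 h.symm).symm, fun h => (bind_toPat_iff.2 h.symm).symm⟩

theorem not_bind_bind {σ ρ : List Comm} : ¬ Unify .bind .bind σ ρ := by
  rintro (_ | _ | _ | _ | ⟨_, c, hc⟩ | ⟨_, c, hc⟩) <;> cases c <;> cases hc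

theorem prot_prot_iff {i j : ℕ} {σ ρ : List Comm} :
    Unify (.prot i) (.prot j) σ ρ ↔ i = j ∧ σ = [] ∧ ρ = [] := by
  constructor
  · rintro ⟨⟩
    exact ⟨rfl, rfl, rfl⟩
  · rintro ⟨rfl, rfl, rfl⟩
    exact .prot_prot i

theorem prot_var_iff {i j : ℕ} {σ ρ : List Comm} :
    Unify (.prot i) (.var j) σ ρ ↔ i = j ∧ σ = [] ∧ ρ = [] := by
  constructor
  · rintro ⟨⟩
    exact ⟨rfl, rfl, rfl⟩
  · rintro ⟨rfl, rfl, rfl⟩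
    exact .prot_var i

theorem not_comp_var {p q : Pat} {i : ℕ} {σ ρ : List Comm} :
    ¬ Unify (.comp p q) (.var i) σ ρ := nofun

theorem not_prot_comp {i : ℕ} {p q : Pat} {σ ρ : List Comm} :
    ¬ Unify (.prot i) (.comp p q) σ ρ := nofun

theorem comp_prot_iff {i : ℕ} {p q : Pat} {σ ρ : List Comm} :
    Unify (.comp (.prot i) p) (.comp (.prot i) q) σ ρ ↔ Unify p q σ ρ := by
  simp [comp_iff, prot_prot_iff]

theorem right_eq_nil {p : Pat} {c : Comm} {σ ρ : List Comm} (h : Unify p c.toPat σ ρ) :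
    ρ = [] := by
  rw [← List.length_eq_zero_iff, h.length_right, Comm.binders_toPat]

end Unify

theorem React.case_case_iff {p q : Pat} {A B : Proc} {c : GClass g} :
    React (.case p A) (.case q B) c ↔ ∃ σ ρ, Unify p q σ ρ ∧
      c = cls g (A.subst (inst σ)) * cls g (B.subst (inst ρ)) := by
  constructor
  · rintro ⟨hu⟩
    exact ⟨_, _, hu.symm, mul_comm _ _⟩
  · rintro ⟨σ, ρ, hu, rfl⟩
    exact React.symm (.unify hu)

theorem Interact.case_case_iff {p q : Pat} {A B : Proc} {c : GClass g} :
    Interact (.case p A) (.case q B) c ↔ React (.case p A) (.case q B) c := by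
  constructor
  · rintro (_ | ⟨_ | ⟨h⟩⟩)
    exact h.symm
  · exact fun h => .case (.case h.symm)

theorem Interact.case_prot_iff {i : ℕ} {p : Pat} {A : Proc} {d : Comm} {c : GClass g} :
    Interact (.case (.comp (.prot i) p) A) (.case (.comp (.prot i) d.toPat) .nil) c ↔
      ∃ σ, Unify p d.toPat σ [] ∧ c = cls g (A.subst (inst σ)) := by
  simp only [case_case_iff, React.case_case_iff, Unify.comp_prot_iff, Proc.subst, cls_nil, mul_one]
  constructor
  · rintro ⟨σ, ρ, hu, rfl⟩
    obtain rfl := hu.right_eq_nil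
    exact ⟨σ, hu, rfl⟩
  · rintro ⟨σ, hu, rfl⟩
    exact ⟨σ, [], hu, rfl⟩

theorem Step.par_case_case_iff {p q : Pat} {A B : Proc} {c : GClass g} :
    Step (.par (.case p A) (.case q B)) c ↔ Interact (.case p A) (.case q B) c := by
  constructor
  · rintro (h | ⟨_, ⟨⟩⟩ | ⟨_, ⟨⟩⟩)
    exact h
  · exact .interact

theorem Step.res_iff {P : Proc} {c : GClass g} :
    Step (.res P) c ↔ ∃ d, Step P d ∧ c = d.res := by
  constructor
  · rintro ⟨⟩
    exact ⟨_, ‹_›, rfl⟩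
  · rintro ⟨d, h, rfl⟩
    exact h.res

theorem Step.res_case_iff {p : Pat} {A : Proc} {d : Comm} {c : GClass g} :
    Step (.res (.par (.case (.comp (.prot 0) p) A) (.case (.comp (.prot 0) d.toPat) .nil))) c ↔
      ∃ σ, Unify p d.toPat σ [] ∧ c = (cls g (A.subst (inst σ))).res := by
  simp only [res_iff, par_case_case_iff, Interact.case_prot_iff]
  constructor
  · rintro ⟨_, ⟨σ, hu, rfl⟩, rfl⟩
    exact ⟨σ, hu, rfl⟩
  · rintro ⟨σ, hu, rfl⟩
    exact ⟨_, ⟨σ, hu, rfl⟩, rfl⟩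

theorem Step.res_case_case_iff {p q : Pat} {A B : Proc} {d : Comm} {c : GClass g}
    (hpq : ∀ σ ρ, ¬ Unify p q σ ρ) :
    Step (.res (.par (.case (.comp (.prot 0) p) A) (.par (.case (.comp (.prot 0) q) B)
        (.case (.comp (.prot 0) d.toPat) .nil)))) c ↔
      (∃ σ, Unify p d.toPat σ [] ∧
        c = (cls g (A.subst (inst σ)) * cls g (.case (.comp (.prot 0) q) B)).res) ∨
      ∃ σ, Unify q d.toPat σ [] ∧
        c = (cls g (B.subst (inst σ)) * cls g (.case (.comp (.prot 0) p) A)).res := by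
  rw [res_iff]
  constructor
  · rintro ⟨_, h | ⟨_, ⟨⟩⟩ | ⟨_, h⟩, rfl⟩
    · rcases h with _ | _ | ⟨_, h⟩ | ⟨_, h⟩
      · obtain ⟨σ, ρ, hu, -⟩ := React.case_case_iff.1 (Interact.case_case_iff.1 h)
        exact (hpq σ ρ (Unify.comp_prot_iff.1 hu)).elim
      · obtain ⟨σ, hu, rfl⟩ := Interact.case_prot_iff.1 h
        exact .inl ⟨σ, hu, by rw [mul_comm]⟩
    · obtain ⟨σ, hu, rfl⟩ := Interact.case_prot_iff.1 (par_case_case_iff.1 h)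
      exact .inr ⟨σ, hu, by rw [mul_comm]⟩
  · rintro (⟨σ, hu, rfl⟩ | ⟨σ, hu, rfl⟩)
    · refine ⟨_, .interact (.parR _ (Interact.case_prot_iff.2 ⟨σ, hu, rfl⟩)), by rw [mul_comm]⟩
    · refine ⟨_, .parR _ (.interact (Interact.case_prot_iff.2 ⟨σ, hu, rfl⟩)), by rw [mul_comm]⟩

/-- Parallel compositions of cases that wait on the protected name `0`; when this name is
restricted, nothing can be observed of them. -/
inductive IsPrivate : Proc → Prop
  | case (p : Pat) (A : Proc) : IsPrivate (.case (.comp (.prot 0) p) A)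
  | par {P Q : Proc} : IsPrivate P → IsPrivate Q → IsPrivate (.par P Q)

theorem IsObservation.not_expose_res {E : Type} {ren : (ℕ → ℕ) → E → E}
    {K : E → Proc → GClass g → Prop} (hK : IsObservation ren K) {P : Proc} (hP : IsPrivate P)
    {e : E} {c : GClass g} : ¬ Expose ren K e (.res P) c := by
  suffices ∀ d, ¬ Expose ren K (ren (· + 1) e) P d by
    rintro ⟨⟩
    exact this _ ‹_›
  induction hP with
  | case p A =>
    intro d h
    cases h with | case h => exact hK.not_dead h
  | par _ _ hP hQ =>
    intro d h
    cases h with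
    | parL _ h => exact hP _ h
    | parR _ h => exact hQ _ h

end CPC

/-! ### Reductions of encodings -/

namespace Spi

variable {ι : ℕ → ℕ} {τ : Tag → ℕ} {g : Prop}

namespace Red

theorem par_symm {P Q R : Proc} (h : Red (.par P Q) R) : Red (.par Q P) R :=
  .struct (.par_comm Q P) h (.refl R)

theorem par_right (P : Proc) {Q Q' : Proc} (h : Red Q Q') : Red (.par P Q) (.par P Q') :=
  .struct (.par_comm P Q) (h.par P) (.par_comm Q' P)

theorem par_par_left {U P R : Proc} (Q : Proc) (h : Red (.par U P) R) :
    Red (.par U (.par P Q)) (.par R Q) :=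
  .struct (.par_assoc U P Q) (h.par Q) (.refl _)

theorem par_par_right {U Q R : Proc} (P : Proc) (h : Red (.par U Q) R) :
    Red (.par U (.par P Q)) (.par P R) :=
  .struct ((Cong.refl U).par (.par_comm P Q)) (h.par_par_left P) (.par_comm R P)

theorem par_repl {U P R : Proc} (h : Red (.par U P) R) :
    Red (.par U (.repl P)) (.par R (.repl P)) :=
  .struct ((Cong.refl U).par (.repl_unfold P)) (h.par_par_left _) (.refl _)

theorem repl {P R : Proc} (h : Red P R) : Red (.repl P) (.par R (.repl P)) :=
  .struct (.repl_unfold P) (h.par _) (.refl _)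

theorem repl_of_par {P R : Proc} (h : Red (.par P P) R) : Red (.repl P) (.par R (.repl P)) :=
  .struct (.repl_unfold P) h.par_repl (.refl _)

theorem par_res {U P R : Proc} (h : Red (.par (U.rename (· + 1)) P) R) :
    Red (.par U (.res P)) (.res R) :=
  .struct (.par_res U P) h.res (.refl _)

end Red

namespace Term

variable {M N : Term} {σ : List CPC.Comm}

open CPC.Unify

theorem unify_encode_iff (h : Admissible ι τ) :
    CPC.Unify (M.encode ι τ).toPat (N.encode ι τ).toPat σ [] ↔ M = N ∧ σ = [] := by
  simp only [toPat_iff, (encode_injective h).eq_iff, and_true]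

theorem unify_encode_comm_iff {M' : Term} {ρ : List CPC.Comm} (h : Admissible ι τ) :
    CPC.Unify (.comp (.comp (M.encode ι τ).toPat .bind) (.var (τ .input)))
        (.comp (.comp (M'.encode ι τ).toPat (N.encode ι τ).toPat) .bind) σ ρ ↔
      M = M' ∧ σ = [N].map (encode ι τ) ∧ ρ = [.name (τ .input)] := by
  have input_iff {σ ρ : List CPC.Comm} : CPC.Unify (.var (τ .input)) .bind σ ρ ↔ _ :=
    toPat_bind_iff (c := .name (τ .input))
  simp [comp_iff, toPat_iff, bind_toPat_iff, input_iff, (encode_injective h).eq_iff]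

section

attribute [local simp] encode CPC.Comm.toPat comp_iff bind_toPat_iff prot_var_iff not_comp_var
  not_prot_comp

theorem unify_encode_pair_iff (h : Admissible ι τ) :
    CPC.Unify (.comp (.comp (.prot (τ .pair)) .bind) .bind) (M.encode ι τ).toPat σ [] ↔
      ∃ M₁ M₂, M = .pair M₁ M₂ ∧ σ = [M₁, M₂].map (encode ι τ) := by
  cases M <;> simp [h.tag_inj.eq_iff]

theorem unify_encode_encr_iff (h : Admissible ι τ) :
    CPC.Unify (.comp (.comp (.prot (τ .encr)) .bind) (N.encode ι τ).toPat) (M.encode ι τ).toPat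
      σ [] ↔ ∃ M₁, M = .encr M₁ N ∧ σ = [M₁].map (encode ι τ) := by
  cases M <;> simp [h.tag_inj.eq_iff, unify_encode_iff h, eq_comm, and_comm]

theorem unify_encode_zero_iff (h : Admissible ι τ) :
    CPC.Unify (.prot (τ .zero)) (M.encode ι τ).toPat σ [] ↔ M = .zero ∧ σ = [] := by
  cases M <;> simp [(h.ne _ _).symm]

theorem unify_encode_suc_iff :
    CPC.Unify (.comp (.prot (τ .suc)) .bind) (M.encode ι τ).toPat σ [] ↔
      ∃ N, M = .suc N ∧ σ = [N].map (encode ι τ) := by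
  cases M <;> simp

end

end Term

namespace Proc

variable {P Q : Proc} {c : CPC.GClass g}

theorem encode_subst_inst_nil (P : Proc) :
    (P.encode (ι · + 1) (τ · + 1)).subst (CPC.inst []) = (P.encode ι τ).rename (· + 1) := by
  rw [encode_rename_add]
  exact encode_subst_inst_shift [] P

theorem encode_subst_inst_add_one (σ : List Term) (P : Proc) :
    (P.encode (liftRenaming σ.length (ι · + 1)) (τ · + 1 + σ.length)).subst
        (CPC.inst (σ.map (Term.encode (ι · + 1) (τ · + 1)))) =
      ((P.subst (inst σ)).encode ι τ).rename (· + 1) := by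
  rw [encode_rename_add]
  exact encode_subst_inst σ P

open CPC (Step cls)

theorem cls_mul_res_subst_inst_nil (P : Proc) (d : CPC.GClass g) :
    (cls g ((P.encode (ι · + 1) (τ · + 1)).subst (CPC.inst [])) * d).res =
      cls g (P.encode ι τ) * d.res := by
  rw [encode_subst_inst_nil, CPC.cls_rename, CPC.GClass.res_rename_mul]

theorem cls_mul_res_subst_inst (σ : List Term) (P : Proc) (d : CPC.GClass g) :
    (cls g ((P.encode (liftRenaming σ.length (ι · + 1)) (τ · + 1 + σ.length)).subst
        (CPC.inst (σ.map (Term.encode (ι · + 1) (τ · + 1))))) * d).res =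
      cls g ((P.subst (inst σ)).encode ι τ) * d.res := by
  rw [encode_subst_inst_add_one, CPC.cls_rename, CPC.GClass.res_rename_mul]

theorem cls_res_subst_inst_nil (P : Proc) :
    (cls g ((P.encode (ι · + 1) (τ · + 1)).subst (CPC.inst []))).res = cls g (P.encode ι τ) := by
  simpa only [mul_one, CPC.GClass.res_one] using cls_mul_res_subst_inst_nil P 1

theorem cls_res_subst_inst (σ : List Term) (P : Proc) :
    (cls g ((P.encode (liftRenaming σ.length (ι · + 1)) (τ · + 1 + σ.length)).subst
        (CPC.inst (σ.map (Term.encode (ι · + 1) (τ · + 1)))))).res =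
      cls g ((P.subst (inst σ)).encode ι τ) := by
  simpa only [mul_one, CPC.GClass.res_one] using cls_mul_res_subst_inst σ P 1

theorem step_encode_test_iff {M N : Term} (h : Admissible ι τ) :
    Step ((test M N P).encode ι τ) c ↔ M = N ∧ c = cls g (P.encode ι τ) := by
  refine CPC.Step.res_case_iff.trans ?_
  simp only [Term.unify_encode_iff (h.shift 1)]
  constructor
  · rintro ⟨_, ⟨rfl, rfl⟩, rfl⟩
    exact ⟨rfl, cls_res_subst_inst_nil P⟩
  · rintro ⟨rfl, rfl⟩
    exact ⟨_, ⟨rfl, rfl⟩, (cls_res_subst_inst_nil P).symm⟩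

theorem step_encode_split_iff {M : Term} (h : Admissible ι τ) :
    Step ((split M P).encode ι τ) c ↔
      ∃ M₁ M₂, M = .pair M₁ M₂ ∧ c = cls g ((P.subst (inst [M₁, M₂])).encode ι τ) := by
  refine CPC.Step.res_case_iff.trans ?_
  simp only [Term.unify_encode_pair_iff (h.shift 1)]
  constructor
  · rintro ⟨_, ⟨M₁, M₂, rfl, rfl⟩, rfl⟩
    exact ⟨M₁, M₂, rfl, cls_res_subst_inst [M₁, M₂] P⟩
  · rintro ⟨M₁, M₂, rfl, rfl⟩
    exact ⟨_, ⟨M₁, M₂, rfl, rfl⟩, (cls_res_subst_inst [M₁, M₂] P).symm⟩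

theorem step_encode_decrypt_iff {M N : Term} (h : Admissible ι τ) :
    Step ((decrypt M N P).encode ι τ) c ↔
      ∃ M₁, M = .encr M₁ N ∧ c = cls g ((P.subst (inst [M₁])).encode ι τ) := by
  refine CPC.Step.res_case_iff.trans ?_
  simp only [Term.unify_encode_encr_iff (h.shift 1)]
  constructor
  · rintro ⟨_, ⟨M₁, rfl, rfl⟩, rfl⟩
    exact ⟨M₁, rfl, cls_res_subst_inst [M₁] P⟩
  · rintro ⟨M₁, rfl, rfl⟩
    exact ⟨_, ⟨M₁, rfl, rfl⟩, (cls_res_subst_inst [M₁] P).symm⟩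

theorem step_encode_intCase_iff {M : Term} {c : CPC.GClass True} (h : Admissible ι τ) :
    Step ((intCase M P Q).encode ι τ) c ↔ (M = .zero ∧ c = cls True (P.encode ι τ)) ∨
      ∃ N, M = .suc N ∧ c = cls True ((Q.subst (inst [N])).encode ι τ) := by
  have zero_res (p A) := (cls_mul_res_subst_inst_nil (ι := ι) (τ := τ) P _).trans
    ((congrArg _ (CPC.cls_res_dead trivial p A)).trans (mul_one _))
  have suc_res (N p A) := (cls_mul_res_subst_inst (ι := ι) (τ := τ) [N] Q _).trans
    ((congrArg _ (CPC.cls_res_dead trivial p A)).trans (mul_one _))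
  refine (CPC.Step.res_case_case_iff fun _ _ => CPC.Unify.not_prot_comp).trans (or_congr ?_ ?_)
  · simp only [Term.unify_encode_zero_iff (h.shift 1)]
    constructor
    · rintro ⟨_, ⟨rfl, rfl⟩, rfl⟩
      exact ⟨rfl, zero_res _ _⟩
    · rintro ⟨rfl, rfl⟩
      exact ⟨_, ⟨rfl, rfl⟩, (zero_res _ _).symm⟩
  · simp only [Term.unify_encode_suc_iff (τ := (τ · + 1))]
    constructor
    · rintro ⟨_, ⟨N, rfl, rfl⟩, rfl⟩
      exact ⟨N, rfl, suc_res N _ _⟩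
    · rintro ⟨N, rfl, rfl⟩
      exact ⟨_, ⟨N, rfl, rfl⟩, (suc_res N _ _).symm⟩

theorem react_encode_iff {M M' N : Term} (h : Admissible ι τ) :
    CPC.React ((out M N P).encode ι τ) ((inp M' Q).encode ι τ) c ↔
      M = M' ∧ c = cls g ((par P (Q.subst (inst [N]))).encode ι τ) := by
  have residual : cls g ((par P (Q.subst (inst [N]))).encode ι τ) =
      cls g ((Q.encode (liftRenaming 1 ι) (τ · + 1)).subst (CPC.inst ([N].map (Term.encode ι τ)))) *
        cls g ((P.encode (ι · + 1) (τ · + 1)).subst (CPC.inst [.name (τ .input)])) :=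
    (mul_comm (cls g _) (cls g _)).trans (congrArg₂ (cls g · * cls g ·)
      (encode_subst_inst [N] Q).symm (encode_subst_inst_shift [.name (τ .input)] P).symm)
  rw [residual]
  constructor
  · intro hr
    obtain ⟨σ, ρ, hu, rfl⟩ := CPC.React.case_case_iff.1 hr.symm
    obtain ⟨rfl, rfl, rfl⟩ := (Term.unify_encode_comm_iff h).1 hu
    exact ⟨rfl, rfl⟩
  · rintro ⟨rfl, rfl⟩
    exact (CPC.React.case_case_iff.2
      ⟨_, _, (Term.unify_encode_comm_iff h).2 ⟨rfl, rfl, rfl⟩, rfl⟩).symm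

theorem not_react_encode_inp_inp {M M' : Term} :
    ¬ CPC.React ((inp M P).encode ι τ) ((inp M' Q).encode ι τ) c := by
  intro h
  obtain ⟨σ, ρ, hu, -⟩ := CPC.React.case_case_iff.1 h
  obtain ⟨_, _, _, _, hu, -⟩ := CPC.Unify.comp_iff.1 hu
  obtain ⟨_, _, _, _, -, hu, -⟩ := CPC.Unify.comp_iff.1 hu
  exact CPC.Unify.not_bind_bind hu

theorem not_react_encode_out_out {M N M' N' : Term} :
    ¬ CPC.React ((out M N P).encode ι τ) ((out M' N' Q).encode ι τ) c := by
  intro h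
  obtain ⟨σ, ρ, hu, -⟩ := CPC.React.case_case_iff.1 h
  obtain ⟨_, _, _, _, -, hu, -⟩ := CPC.Unify.comp_iff.1 hu
  exact CPC.Unify.not_bind_bind hu

theorem exists_red_of_react_encode {U T : Proc} (h : Admissible ι τ)
    (hUT : CPC.React (U.encode ι τ) (T.encode ι τ) c) :
    ∃ R, Red (.par U T) R ∧ c = cls g (R.encode ι τ) := by
  cases U with
  | inp M P =>
    cases T with
    | inp => exact (not_react_encode_inp_inp hUT).elim
    | out M' N Q =>
      obtain ⟨rfl, rfl⟩ := (react_encode_iff h).1 hUT.symm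
      exact ⟨_, Red.par_symm (.comm _ _ _ _), rfl⟩
    | _ => cases hUT
  | out M N P =>
    cases T with
    | inp M' Q =>
      obtain ⟨rfl, rfl⟩ := (react_encode_iff h).1 hUT
      exact ⟨_, .comm _ _ _ _, rfl⟩
    | out => exact (not_react_encode_out_out hUT).elim
    | _ => cases hUT
  | _ => cases hUT

theorem exists_red_of_expose_encode {K : CPC.Proc → CPC.Proc → CPC.GClass g → Prop}
    (hK : CPC.IsObservation CPC.Proc.rename K)
    (hKenc : ∀ {ι τ U T c}, Admissible ι τ → K (encode ι τ U) (encode ι τ T) c →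
      ∃ R, Red (.par U T) R ∧ c = cls g (R.encode ι τ))
    {U : Proc} (h : Admissible ι τ)
    (hUP : CPC.Expose CPC.Proc.rename K (U.encode ι τ) (P.encode ι τ) c) :
    ∃ R, Red (.par U P) R ∧ c = cls g (R.encode ι τ) := by
  induction P generalizing ι τ U c with
  | nil => cases hUP
  | ok => cases hUP with | ok hUP => exact hKenc h hUP
  | par P Q hP hQ =>
    cases hUP with
    | parL _ hUP =>
      obtain ⟨R, hR, rfl⟩ := hP h hUP
      exact ⟨_, hR.par_par_left Q, rfl⟩
    | parR _ hUP =>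
      obtain ⟨R, hR, rfl⟩ := hQ h hUP
      exact ⟨_, hR.par_par_right P, rfl⟩
  | repl P hP =>
    cases hUP with
    | repl hUP =>
      obtain ⟨R, hR, rfl⟩ := hP h hUP
      exact ⟨_, hR.par_repl, rfl⟩
  | res P hP =>
    cases hUP with
    | res hUP =>
      rw [encode_rename_add_lift] at hUP
      obtain ⟨R, hR, rfl⟩ := hP (h.lift 1) hUP
      exact ⟨_, hR.par_res, rfl⟩
  | inp | out => cases hUP with | case hUP => exact hKenc h hUP
  | test | split | decrypt => exact (hK.not_expose_res (.par (.case _ _) (.case _ _)) hUP).elim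
  | intCase =>
    exact (hK.not_expose_res (.par (.case _ _) (.par (.case _ _) (.case _ _))) hUP).elim

theorem exists_red_of_interact_encode {U : Proc} (h : Admissible ι τ)
    (hUP : CPC.Interact (U.encode ι τ) (P.encode ι τ) c) :
    ∃ R, Red (.par U P) R ∧ c = cls g (R.encode ι τ) := by
  refine exists_red_of_expose_encode (CPC.ReactWith.isObservation g) (fun h hUT => ?_) h hUP
  obtain ⟨R, hR, rfl⟩ := exists_red_of_expose_encode (CPC.React.isObservation g)
    exists_red_of_react_encode h hUT
  exact ⟨R, hR.par_symm, rfl⟩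

theorem exists_red_of_step_encode {c : CPC.GClass True} (h : Admissible ι τ)
    (hP : Step (P.encode ι τ) c) : ∃ R, Red P R ∧ c = cls True (R.encode ι τ) := by
  induction P generalizing ι τ c with
  | nil => cases hP
  | ok => cases hP
  | par P Q ihP ihQ =>
    cases hP with
    | interact hPQ => exact exists_red_of_interact_encode h hPQ
    | parL _ hP =>
      obtain ⟨R, hR, rfl⟩ := ihP h hP
      exact ⟨_, hR.par Q, rfl⟩
    | parR _ hQ =>
      obtain ⟨R, hR, rfl⟩ := ihQ h hQ
      exact ⟨_, hR.par_right P, rfl⟩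
  | repl P ih =>
    cases hP with
    | repl hP =>
      obtain ⟨R, hR, rfl⟩ := ih h hP
      exact ⟨_, hR.repl, rfl⟩
    | repl_interact hP =>
      obtain ⟨R, hR, rfl⟩ := exists_red_of_interact_encode h hP
      exact ⟨_, hR.repl_of_par, rfl⟩
  | res P ih =>
    cases hP with
    | res hP =>
      obtain ⟨R, hR, rfl⟩ := ih (h.lift 1) hP
      exact ⟨_, hR.res, rfl⟩
  | inp | out => cases hP
  | test M N P =>
    obtain ⟨rfl, rfl⟩ := (step_encode_test_iff h).1 hP
    exact ⟨_, .test _ _, rfl⟩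
  | split M P =>
    obtain ⟨M₁, M₂, rfl, rfl⟩ := (step_encode_split_iff h).1 hP
    exact ⟨_, .split _ _ _, rfl⟩
  | decrypt M N P =>
    obtain ⟨M₁, rfl, rfl⟩ := (step_encode_decrypt_iff h).1 hP
    exact ⟨_, .decrypt _ _ _, rfl⟩
  | intCase M P Q =>
    obtain ⟨rfl, rfl⟩ | ⟨N, rfl, rfl⟩ := (step_encode_intCase_iff h).1 hP
    · exact ⟨_, .intCase_zero _ _, rfl⟩
    · exact ⟨_, .intCase_suc _ _ _, rfl⟩

theorem step_encode_of_red (h : Admissible ι τ) {R : Proc} (hR : Red P R) :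
    Step (P.encode ι τ) (cls True (R.encode ι τ)) := by
  induction hR generalizing ι τ with
  | comm M N P Q =>
    exact .interact (CPC.ReactWith.interact (.case ((react_encode_iff h).2 ⟨rfl, rfl⟩)))
  | test M P => exact (step_encode_test_iff h).2 ⟨rfl, rfl⟩
  | split M N P => exact (step_encode_split_iff h).2 ⟨M, N, rfl, rfl⟩
  | decrypt M N P => exact (step_encode_decrypt_iff h).2 ⟨M, rfl, rfl⟩
  | intCase_zero P Q => exact (step_encode_intCase_iff h).2 (.inl ⟨rfl, rfl⟩)
  | intCase_suc N P Q => exact (step_encode_intCase_iff h).2 (.inr ⟨N, rfl, rfl⟩)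
  | par Q _ ih => exact (ih h).parL _
  | res _ ih => exact (ih (h.lift 1)).res
  | struct hPQ _ hQP ih =>
    have hstep := CPC.Step.gcong ((hPQ.symm.encode ι τ).gcong True) (ih h)
    rwa [((hQP.encode ι τ).gcong True).cls_eq] at hstep

theorem step_encode_iff {c : CPC.GClass True} (h : Admissible ι τ) :
    Step (P.encode ι τ) c ↔ ∃ R, Red P R ∧ c = cls True (R.encode ι τ) := by
  refine ⟨exists_red_of_step_encode h, ?_⟩
  rintro ⟨R, hR, rfl⟩
  exact step_encode_of_red h hR

end Proc

end Spi

/-! ### Operational correspondence, divergence and success -/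

namespace Spi

variable {ι : ℕ → ℕ} {τ : Tag → ℕ} {P : Proc}

theorem Cong.exists_cong_par_ok {P P' Q : Proc} (hP : Cong P (.par P' .ok)) :
    ∃ R, Cong (.par P Q) (.par R .ok) :=
  ⟨.par Q P', (Cong.par_comm P Q).trans (((Cong.refl Q).par hP).trans (.par_assoc Q P' .ok))⟩

theorem exists_cong_par_ok_of_exposesOk_encode {g : Prop} {c : CPC.GClass g}
    (h : CPC.ExposesOk (P.encode ι τ) c) : ∃ Q, Cong P (.par Q .ok) := by
  have hobs := CPC.ShowsOk.isObservation g
  induction P generalizing ι τ c with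
  | nil => cases h
  | ok => exact ⟨.nil, ((Cong.par_nil .ok).symm).trans (.par_comm _ _)⟩
  | par P Q hP hQ =>
    cases h with
    | parL _ h =>
      obtain ⟨P', hP'⟩ := hP h
      exact hP'.exists_cong_par_ok
    | parR _ h =>
      obtain ⟨Q', hQ'⟩ := hQ h
      obtain ⟨R, hR⟩ := hQ'.exists_cong_par_ok (Q := P)
      exact ⟨R, (Cong.par_comm P Q).trans hR⟩
  | repl P hP =>
    cases h with
    | repl h =>
      obtain ⟨P', hP'⟩ := hP h
      obtain ⟨R, hR⟩ := hP'.exists_cong_par_ok (Q := .repl P)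
      exact ⟨R, (Cong.repl_unfold P).trans hR⟩
  | res P hP =>
    cases h with
    | res h =>
      obtain ⟨P', hP'⟩ := hP h
      exact ⟨.res P', hP'.res.trans ((Cong.par_comm _ _).res.trans
        ((Cong.par_res .ok P').symm.trans (.par_comm _ _)))⟩
  | inp | out => cases h with | case h => cases h
  | test | split | decrypt => exact (hobs.not_expose_res (.par (.case _ _) (.case _ _)) h).elim
  | intCase =>
    exact (hobs.not_expose_res (.par (.case _ _) (.par (.case _ _) (.case _ _))) h).elim

theorem Red.exists_red_encode {P' : Proc} (h : Admissible ι τ) (hr : Red P P') :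
    ∃ Q, CPC.Red (P.encode ι τ) Q ∧ CPC.GCong True Q (P'.encode ι τ) := by
  obtain ⟨Q, hQ, hQP⟩ := (Proc.step_encode_iff h).2 ⟨P', hr, rfl⟩ |>.exists_red
  exact ⟨Q, hQ, CPC.cls_eq_cls.1 hQP⟩

theorem exists_red_of_red_encode {Q : CPC.Proc} (h : Admissible ι τ)
    (hr : CPC.Red (P.encode ι τ) Q) : ∃ P', Red P P' ∧ CPC.GCong True Q (P'.encode ι τ) := by
  obtain ⟨P', hP, hQ⟩ := (Proc.step_encode_iff h).1 (hr.step True)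
  exact ⟨P', hP, CPC.cls_eq_cls.1 hQ⟩

theorem exists_red_of_gcong_encode {Q Q' : CPC.Proc} (h : Admissible ι τ)
    (hQ : CPC.GCong True Q (P.encode ι τ)) (hr : CPC.Red Q Q') :
    ∃ P', Red P P' ∧ CPC.GCong True Q' (P'.encode ι τ) := by
  obtain ⟨R, hR, hQR⟩ := hQ.red hr
  obtain ⟨P', hP, hRP⟩ := exists_red_of_red_encode h hR
  exact ⟨P', hP, hQR.trans hRP⟩

theorem exists_reds_encode {P' : Proc} (h : Admissible ι τ)
    (hr : Relation.ReflTransGen Red P P') :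
    ∃ Q, Relation.ReflTransGen CPC.Red (P.encode ι τ) Q ∧ CPC.GCong True Q (P'.encode ι τ) := by
  induction hr with
  | refl => exact ⟨_, .refl, .refl _⟩
  | tail _ hr ih =>
    obtain ⟨Q, hPQ, hQ⟩ := ih
    obtain ⟨R, hPR, hR⟩ := hr.exists_red_encode h
    obtain ⟨R', hQR, hR'⟩ := hQ.symm.red hPR
    exact ⟨R', hPQ.tail hQR, hR'.symm.trans hR⟩

theorem exists_reds_of_reds_encode {Q : CPC.Proc} (h : Admissible ι τ)
    (hr : Relation.ReflTransGen CPC.Red (P.encode ι τ) Q) :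
    ∃ P', Relation.ReflTransGen Red P P' ∧ CPC.GCong True Q (P'.encode ι τ) := by
  induction hr with
  | refl => exact ⟨P, .refl, .refl _⟩
  | tail _ hr ih =>
    obtain ⟨P₁, hP₁, hQ₁⟩ := ih
    obtain ⟨P₂, hP₂, hQ₂⟩ := exists_red_of_gcong_encode h hQ₁ hr
    exact ⟨P₂, hP₁.tail hP₂, hQ₂⟩

theorem diverges_of_diverges_encode (h : Admissible ι τ) (hd : CPC.Diverges (P.encode ι τ)) :
    Diverges P := by
  obtain ⟨F, hF₀, hF⟩ := hd
  have next (i : ℕ) (S : {S : Proc // CPC.GCong True (F i) (S.encode ι τ)}) :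
      ∃ S' : {S : Proc // CPC.GCong True (F (i + 1)) (S.encode ι τ)}, Red S S' := by
    obtain ⟨S', hr, hS'⟩ := exists_red_of_gcong_encode h S.2 (hF i)
    exact ⟨⟨S', hS'⟩, hr⟩
  choose G hG using next
  let S (i : ℕ) : {S : Proc // CPC.GCong True (F i) (S.encode ι τ)} :=
    Nat.rec ⟨P, hF₀ ▸ .refl _⟩ (fun i S => G i S) i
  exact ⟨fun i => (S i).1, rfl, fun i => hG i (S i)⟩

theorem succeeds_iff_succeeds_encode (h : Admissible ι τ) :
    Succeeds P ↔ CPC.Succeeds (P.encode ι τ) := by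
  constructor
  · rintro ⟨P', P'', hr, hok⟩
    obtain ⟨Q, hPQ, hQ⟩ := exists_reds_encode h hr
    obtain ⟨Q', hQ'⟩ := hQ.symm.exists_cong_par_ok ⟨_, hok.encode ι τ⟩
    exact ⟨Q, Q', hPQ, hQ'⟩
  · rintro ⟨Q, Q', hr, hok⟩
    obtain ⟨P', hPP', hQ⟩ := exists_reds_of_reds_encode h hr
    obtain ⟨_, hexp⟩ := (CPC.exists_cong_par_ok_iff True).1 (hQ.exists_cong_par_ok ⟨_, hok⟩)
    obtain ⟨P'', hP''⟩ := exists_cong_par_ok_of_exposesOk_encode hexp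
    exact ⟨P', P'', hPP', hP''⟩

end Spi

/-! ### Name invariance and compositionality -/

theorem closeNames_nil : closeNames [] = id := rfl

theorem closeNames_of_notMem {xs : List ℕ} {n : ℕ} (h : n ∉ xs) :
    closeNames xs n = n + xs.length := if_neg h

theorem closeNames_map {f : ℕ → ℕ} (hf : Function.Injective f) (xs : List ℕ) (n : ℕ) :
    closeNames (xs.map f) (f n) = liftRenaming xs.length f (closeNames xs n) := by
  by_cases h : n ∈ xs
  · have idxOf_map : (xs.map f).idxOf (f n) = xs.idxOf n := by
      clear h
      induction xs with
      | nil => rfl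
      | cons x xs ih =>
        rw [List.map_cons, List.idxOf_cons, List.idxOf_cons, ih, beq_eq_beq.2 hf.eq_iff]
    rw [closeNames, if_pos (List.mem_map_of_mem h), closeNames, if_pos h, idxOf_map,
      liftRenaming_lt _ (List.idxOf_lt_length_of_mem h)]
  · rw [closeNames_of_notMem h, closeNames_of_notMem (by simpa [hf.eq_iff] using h),
      liftRenaming_add, List.length_map]

theorem closeNames_closeNames_map {f : ℕ → ℕ} (hf : Function.Injective f) {xs : List ℕ} {a n : ℕ}
    (h : f a ≠ n) : liftRenaming xs.length (closeNames [n]) (closeNames (xs.map f) (f a)) =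
      liftRenaming xs.length (f · + 1) (closeNames xs a) := by
  rw [closeNames_map hf]
  by_cases ha : a ∈ xs
  · have hlt : closeNames xs a < xs.length := by
      rw [closeNames, if_pos ha]
      exact List.idxOf_lt_length_of_mem ha
    simp only [liftRenaming_lt _ hlt]
  · rw [closeNames_of_notMem ha]
    simp only [liftRenaming_add]
    rw [closeNames_of_notMem (by simpa using h), List.length_singleton]

namespace Spi

variable {ι : ℕ → ℕ} {τ : Tag → ℕ}

theorem encode_name_invariance (h : Admissible ι τ) (σ : ℕ → ℕ) : ∃ σ' : ℕ → ℕ,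
    (∀ a, ι (σ a) = σ' (ι a)) ∧ (∀ c, (∀ a, ι a ≠ c) → σ' c = c) ∧
    ∀ P : Proc, (P.rename σ).encode ι τ = (P.encode ι τ).rename σ' := by
  have extends_σ a : ι (σ a) = Function.extend ι (ι ∘ σ) id (ι a) :=
    (h.inj.extend_apply (ι ∘ σ) id a).symm
  have fixes_rest c (hc : ∀ a, ι a ≠ c) : Function.extend ι (ι ∘ σ) id c = c :=
    Function.extend_apply' _ _ c fun ⟨a, ha⟩ => hc a ha
  exact ⟨_, extends_σ, fixes_rest, fun P => (Proc.encode_rename P (fun a _ => (extends_σ a).symm)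
    fun t => fixes_rest _ fun a => h.ne a t).symm⟩

theorem Admissible.tag_notMem_map (h : Admissible ι τ) (t : Tag) (xs : List ℕ) :
    τ t ∉ xs.map ι := by
  simpa using fun a _ => h.ne a t

theorem Proc.encode_rename_closeNames (h : Admissible ι τ) (xs : List ℕ) (P : Proc) :
    (P.encode ι τ).rename (closeNames (xs.map ι)) =
      (P.rename (closeNames xs)).encode (liftRenaming xs.length ι) (τ · + xs.length) :=
  encode_rename P (fun a _ => closeNames_map h.inj xs a) fun t => by
    rw [closeNames_of_notMem (h.tag_notMem_map t xs), List.length_map]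

/-- The name `n` does not occur in encodings of terms and processes with free names in `N`. -/
structure Fresh (ι : ℕ → ℕ) (τ : Tag → ℕ) (N : Set ℕ) (n : ℕ) : Prop where
  name : ∀ a ∈ N, ι a ≠ n
  tag : ∀ t, τ t ≠ n

namespace Fresh

variable {N N' : Set ℕ} {n : ℕ}

theorem mono (h : Fresh ι τ N' n) (hN : N ⊆ N') : Fresh ι τ N n :=
  ⟨fun a ha => h.name a (hN ha), h.tag⟩

theorem closeNames_name (h : Fresh ι τ N n) {a : ℕ} (ha : a ∈ N) :
    closeNames [n] (ι a) = ι a + 1 :=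
  closeNames_of_notMem (by simpa using h.name a ha)

theorem closeNames_tag (h : Fresh ι τ N n) (t : Tag) : closeNames [n] (τ t) = τ t + 1 :=
  closeNames_of_notMem (by simpa using h.tag t)

end Fresh

theorem exists_fresh (ι : ℕ → ℕ) (τ : Tag → ℕ) {N : Set ℕ} (hN : N.Finite) :
    ∃ n, Fresh ι τ N n := by
  have finite_tags : (Set.range τ).Finite := by
    refine (Set.toFinite {τ .pair, τ .encr, τ .zero, τ .suc, τ .input}).subset ?_
    rintro _ ⟨t, rfl⟩
    cases t <;> simp
  obtain ⟨n, hn⟩ := ((hN.image ι).union finite_tags).exists_notMem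
  exact ⟨n, fun a ha e => hn (.inl ⟨a, ha, e⟩), fun t e => hn (.inr ⟨t, e⟩)⟩

theorem Term.encode_subst_closeNames {n : ℕ} {M : Term} (h : Fresh ι τ M.fn n) :
    ((M.encode ι τ).subst fun a => .name (closeNames [n] a)) =
      M.encode (ι · + 1) (τ · + 1) := by
  rw [encode_subst (f := .name) (ι' := (ι · + 1)) (τ' := (τ · + 1)), subst_name]
  exact ⟨fun a ha => congrArg _ (h.closeNames_name ha), fun t => congrArg _ (h.closeNames_tag t)⟩

theorem Proc.encode_rename_closeNames_fresh {n : ℕ} {P : Proc} (h : Fresh ι τ P.fn n) :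
    (P.encode ι τ).rename (closeNames [n]) = P.encode (ι · + 1) (τ · + 1) :=
  (encode_rename (f := id) (ι' := (ι · + 1)) P (fun _ ha => h.closeNames_name ha)
    h.closeNames_tag).trans (congrArg _ P.subst_name)

theorem Proc.encode_rename_closeNames_lift (h : Admissible ι τ) {n : ℕ} {P : Proc}
    (hn : Fresh ι τ P.fn n) (xs : List ℕ) :
    ((P.encode ι τ).rename (closeNames (xs.map ι))).rename
        (liftRenaming xs.length (closeNames [n])) =
      (P.rename (closeNames xs)).encode (liftRenaming xs.length (ι · + 1))
        (τ · + 1 + xs.length) := by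
  rw [CPC.Proc.rename_rename]
  refine encode_rename P (fun a ha => closeNames_closeNames_map h.inj (hn.name a ha)) fun t => ?_
  rw [Function.comp_apply, closeNames_of_notMem (h.tag_notMem_map t xs), List.length_map,
    liftRenaming_add, hn.closeNames_tag]

theorem Term.finite_fn (M : Term) : M.fn.Finite := by
  induction M with
  | name n => exact Set.finite_singleton n
  | zero => exact Set.finite_empty
  | suc _ hM => exact hM
  | pair M N hM hN | encr M N hM hN => exact hM.union hN

theorem finite_setOf_add_mem {s : Set ℕ} (h : s.Finite) (k : ℕ) : {n | n + k ∈ s}.Finite :=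
  h.preimage (add_left_injective k).injOn

theorem Proc.finite_fn (P : Proc) : P.fn.Finite := by
  induction P with
  | nil | ok => exact Set.finite_empty
  | par P Q hP hQ => exact hP.union hQ
  | repl _ hP => exact hP
  | res P hP => exact finite_setOf_add_mem hP 1
  | inp M P hP => exact M.finite_fn.union (finite_setOf_add_mem hP 1)
  | out M N P hP | test M N P hP => exact (M.finite_fn.union N.finite_fn).union hP
  | split M P hP => exact M.finite_fn.union (finite_setOf_add_mem hP 2)
  | decrypt M N P hP => exact (M.finite_fn.union N.finite_fn).union (finite_setOf_add_mem hP 1)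
  | intCase M P Q hP hQ => exact (M.finite_fn.union hP).union (finite_setOf_add_mem hQ 1)

namespace Op

/-- The names in the terms of an operator, which the context that encodes it must not capture. -/
def termNames : Op → Set ℕ
  | inp M _ | split _ _ _ M | intCase M _ => M.fn
  | out M N | test M N | decrypt M _ N => M.fn ∪ N.fn
  | nil | ok | par | repl | res _ => ∅

theorem finite_termNames (op : Op) : op.termNames.Finite := by
  cases op <;> simp [termNames, Term.finite_fn]

/-- The context that encodes an operator; `n` is used where a fresh name is needed. -/
def context (ι : ℕ ↪ ℕ) (τ : Tag → ℕ) (n : ℕ) : Op → CPC.Ctx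
  | nil => .nil
  | ok => .ok
  | par => .par (.hole 0) (.hole 1)
  | repl => .repl (.hole 0)
  | res m => .res (ι m) (.hole 0)
  | inp M x =>
      .case (.comp (.comp (M.encode ι τ).toPat .bind) (.var (τ .input))) [ι x]
        (by simp [CPC.Pat.binders]) (.hole 0)
  | out M N =>
      .case (.comp (.comp (M.encode ι τ).toPat (N.encode ι τ).toPat) .bind) [n]
        (by simp [CPC.Pat.binders]) (.hole 0)
  | test M N =>
      .res n (.par
        (.case (.comp (.prot n) (M.encode ι τ).toPat) [] (by simp [CPC.Pat.binders]) (.hole 0))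
        (.case (.comp (.prot n) (N.encode ι τ).toPat) [] (by simp [CPC.Pat.binders]) .nil))
  | split x y h M =>
      .res n (.par
        (.case (.comp (.prot n) (.comp (.comp (.prot (τ .pair)) .bind) .bind)) [ι x, ι y]
          (by simp [CPC.Pat.binders, h]) (.hole 0))
        (.case (.comp (.prot n) (M.encode ι τ).toPat) [] (by simp [CPC.Pat.binders]) .nil))
  | decrypt M x N =>
      .res n (.par
        (.case (.comp (.prot n) (.comp (.comp (.prot (τ .encr)) .bind) (N.encode ι τ).toPat)) [ι x]
          (by simp [CPC.Pat.binders]) (.hole 0))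
        (.case (.comp (.prot n) (M.encode ι τ).toPat) [] (by simp [CPC.Pat.binders]) .nil))
  | intCase M x =>
      .res n (.par
        (.case (.comp (.prot n) (.prot (τ .zero))) [] (by simp [CPC.Pat.binders]) (.hole 0))
        (.par
          (.case (.comp (.prot n) (.comp (.prot (τ .suc)) .bind)) [ι x]
            (by simp [CPC.Pat.binders]) (.hole 1))
          (.case (.comp (.prot n) (M.encode ι τ).toPat) [] (by simp [CPC.Pat.binders]) .nil)))

theorem isContext_context (ι : ℕ ↪ ℕ) (τ : Tag → ℕ) (n : ℕ) (op : Op) :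
    (op.context ι τ n).IsContext op.arity := by
  cases op <;> rfl

section

attribute [local simp] apply context Proc.encode CPC.Ctx.plug CPC.Pat.subst CPC.Pat.binders
  CPC.Comm.subst_toPat CPC.Comm.protect Term.encode_subst_closeNames
  Proc.encode_rename_closeNames_fresh closeNames_nil liftRenaming_zero CPC.Proc.rename_id

theorem plug_context {ι : ℕ ↪ ℕ} (h : Admissible ι τ) {n : ℕ} (op : Op) (S : ℕ → Proc)
    (hn : Fresh ι τ op.termNames n) (hS : ∀ i < op.arity, Fresh ι τ (S i).fn n) :
    (op.apply S).encode ι τ = (op.context ι τ n).plug fun i => (S i).encode ι τ := by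
  have private_name : closeNames [n] n = 0 := by simp [closeNames]
  cases op with
  | nil | ok | par | repl => rfl
  | res m => exact congrArg _ (Proc.encode_rename_closeNames h [m] (S 0)).symm
  | inp M x => exact congrArg _ (Proc.encode_rename_closeNames h [x] (S 0)).symm
  | out M N => simp [hS 0 one_pos]
  | test M N =>
    have hM : Fresh ι τ M.fn n := hn.mono Set.subset_union_left
    have hN : Fresh ι τ N.fn n := hn.mono Set.subset_union_right
    simp [private_name, hM, hN, hS 0 one_pos]
  | split x y _ M =>
    have hM : Fresh ι τ M.fn n := hn
    have encode_body := Proc.encode_rename_closeNames_lift h (hS 0 one_pos) [x, y]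
    simp only [List.map, List.length] at encode_body
    simp [private_name, hM, hn.closeNames_tag, encode_body]
  | decrypt M x N =>
    have hM : Fresh ι τ M.fn n := hn.mono Set.subset_union_left
    have hN : Fresh ι τ N.fn n := hn.mono Set.subset_union_right
    have encode_body := Proc.encode_rename_closeNames_lift h (hS 0 one_pos) [x]
    simp only [List.map, List.length] at encode_body
    simp [private_name, hM, hN, hn.closeNames_tag, encode_body]
  | intCase M x =>
    have hM : Fresh ι τ M.fn n := hn
    have encode_body := Proc.encode_rename_closeNames_lift h (hS 1 one_lt_two) [x]
    simp only [List.map, List.length] at encode_body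
    simp [private_name, hM, hn.closeNames_tag, hS 0 two_pos, encode_body]

end

end Op

theorem encode_compositional {ι : ℕ ↪ ℕ} (h : Admissible ι τ) (op : Op) (N : Set ℕ) :
    ∃ C : CPC.Ctx, C.IsContext op.arity ∧
      ∀ S : ℕ → Proc, (⋃ i < op.arity, (S i).fn) = N →
        (op.apply S).encode ι τ = C.plug fun i => (S i).encode ι τ := by
  by_cases hN : N.Finite
  · obtain ⟨n, hn⟩ := exists_fresh ι τ (hN.union op.finite_termNames)
    refine ⟨op.context ι τ n, op.isContext_context ι τ n, fun S hS => ?_⟩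
    have fn_subset i (hi : i < op.arity) : (S i).fn ⊆ N := by
      rw [← hS]
      exact Set.subset_biUnion_of_mem (u := fun i => (S i).fn) (s := {i | i < op.arity}) hi
    exact op.plug_context h S (hn.mono Set.subset_union_right) fun i hi =>
      hn.mono ((fn_subset i hi).trans Set.subset_union_left)
  · refine ⟨op.context ι τ 0, op.isContext_context ι τ 0, fun S hS => (hN ?_).elim⟩
    rw [← hS]
    exact (Set.finite_lt_nat op.arity).biUnion fun i _ => (S i).finite_fn

end Spi

/-- For every choice `ι` of CPC names for the Spi names and every choice `τ` of reserved names. -/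
theorem mainTheorem6 (ι : ℕ ↪ ℕ) (τ : Tag ↪ ℕ) (h : ∀ a t, ι a ≠ τ t) :
    IsValidEncoding (Spi.Proc.encode ι τ) (fun a (_ : Fin 1) => ι a) ∧
    (∀ P P' : Spi.Proc, Spi.Red P P' →
      ∃ Q : CPC.Proc, CPC.Red (P.encode ι τ) Q ∧ CPC.BarbedCong Q (P'.encode ι τ)) ∧
    (∀ (P : Spi.Proc) (Q : CPC.Proc), CPC.Red (P.encode ι τ) Q →
      ∃ P' : Spi.Proc, Spi.Red P P' ∧ CPC.BarbedCong Q (P'.encode ι τ)) := by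
  have ha : Spi.Admissible ι τ := ⟨ι.injective, τ.injective, h⟩
  refine ⟨⟨one_pos, Spi.encode_compositional ha, fun σ => ?_, fun S S' hr => ?_,
    fun S T hr => ?_, fun S => Spi.diverges_of_diverges_encode ha,
    fun S => Spi.succeeds_iff_succeeds_encode ha⟩, fun P P' hr => ?_, fun P Q hr => ?_⟩
  · obtain ⟨σ', extends_σ, fixes_rest, encode_rename⟩ := Spi.encode_name_invariance ha σ
    refine ⟨σ', fun a _ => extends_σ a, fun c hc => fixes_rest c fun a => hc a 0,
      fun S => ⟨fun _ => encode_rename S, fun _ => ?_⟩⟩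
    rw [encode_rename S]
    exact (CPC.GCong.refl (g := True) _).barbedCong
  · obtain ⟨Q, hQ, hcong⟩ := Spi.exists_reds_encode ha hr
    exact ⟨Q, hQ, hcong.barbedCong⟩
  · obtain ⟨S', hS', hcong⟩ := Spi.exists_reds_of_reds_encode ha hr
    exact ⟨S', T, hS', .refl, hcong.barbedCong⟩
  · obtain ⟨Q, hQ, hcong⟩ := hr.exists_red_encode ha
    exact ⟨Q, hQ, hcong.barbedCong⟩
  · obtain ⟨P', hP', hcong⟩ := Spi.exists_red_of_red_encode ha hr
    exact ⟨P', hP', hcong.barbedCong⟩
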